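/- Let $\Sigma$ be a finite alphabet, $1\notin\Sigma$ a separator and $k\ge 0$. For words $u,v$ over $\Sigma\cup\{1\}$ with at least $j\ge 1$ separators in $u$, let $u\odot_j v$ be the result of replacing the $j$-th separator of $u$ by $v$. Let $N$ be a finite set of nonterminals, each with a rank $\mathrm{rk}(A)\in\{0,\dots,k\}$. The $k$-correct terms and their ranks are defined inductively: every $A\in N$ is a term of rank $\mathrm{rk}(A)$; every $w\in\Sigma^*$ is a term of rank $0$; $1$ is a term of rank $1$; if $\alpha,\beta$ are terms with $\mathrm{rk}(\alpha)+\mathrm{rk}(\beta)\le k$, then $(\alpha\cdot\beta)$ is a term of rank $\mathrm{rk}(\alpha)+\mathrm{rk}(\beta)$; if $\alpha,\beta$ are terms, $1\le j\le k$, $j\le\mathrm{rk}(\alpha)$ and $\mathrm{rk}(\alpha)+\mathrm{rk}(\beta)\le k+1$, then $(\alpha\odot_j\beta)$ is a term of rank $\mathrm{rk}(\alpha)+\mathrm{rk}(\beta)-1$. A $k$-displacement context-free grammar ($k$-DCFG) consists of $\Sigma$, $N$, a start symbol $S\in N$ of rank $0$ and a finite set of rules $A\to\alpha$ with $A\in N$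 and $\alpha$ a $k$-correct term of rank $\mathrm{rk}(A)$. Starting from the term $S$, one may repeatedly replace an occurrence of a nonterminal $B$ by $\beta$ for a rule $B\to\beta$; the language of the grammar is the set of values in $\Sigma^*$ of the derivable terms without nonterminals, where $\cdot$ is read as concatenation and $\odot_j$ as above. A $k$-DCFL is the language of some $k$-DCFG. Theorem (pumping lemma). For every $k$-DCFL $L\subseteq\Sigma^*$ there is a number $n\in\mathbb{N}$ such that every word $w\in L$ with $|w|>n$ can be written as $$w=s_0\,y_1u_1z_1\,s_1\,y_2u_2z_2\,s_2\cdots y_lu_lz_l\,s_l$$ for some $l\le k+1$ and words $s_i,y_i,u_i,z_i\in\Sigma^*$ such that 1. $|y_1z_1\cdots y_lz_l|>0$; 2. $|y_1u_1z_1\cdots y_lu_lz_l|\le n$; 3. for every integer $p\ge 0$, the word $s_0\,y_1^pu_1z_1^p\,s_1\cdots y_l^pu_lz_l^p\,s_l$ belongs to $L$. -/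

import Mathlib

namespace Displacement

/-- Words over the alphabet `σ` extended by one distinguished separator, which is `none`. -/
abbrev SepWord (σ : Type*) := List (Option σ)

/-- `intercal j u v` replaces the `j`-th separator of `u` (counted from `1`) by `v`. It is only
used for `j` between `1` and the number of separators of `u`. -/
def intercal {σ : Type*} : ℕ → SepWord σ → SepWord σ → SepWord σ
  | _, [], _ => []
  | j, some a :: u, v => some a :: intercal j u v
  | 0, none :: u, _ => none :: u
  | 1, none :: u, v => v ++ u
  | j + 2, none :: u, v => none :: intercal (j + 1) u v

/-- Raw terms over nonterminals `N` and alphabet `σ`. -/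
inductive Tm (N σ : Type*) where
  | nt (A : N)
  | word (w : List σ)
  | sep
  | conc (α β : Tm N σ)
  | inter (j : ℕ) (α β : Tm N σ)

namespace Tm

variable {N σ : Type*}

/-- The rank of a term, given the ranks of the nonterminals. In a correct term the subtraction
does not truncate, because there `1 ≤ j ≤ α.rank rk` in every subterm `inter j α β`. -/
def rank (rk : N → ℕ) : Tm N σ → ℕ
  | nt A => rk A
  | word _ => 0
  | sep => 1
  | conc α β => α.rank rk + β.rank rk
  | inter _ α β => α.rank rk + β.rank rk - 1

/-- `k`-correct terms: the set `Tm_k(N, Σ)`. -/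
def Correct (k : ℕ) (rk : N → ℕ) : Tm N σ → Prop
  | nt _ => True
  | word _ => True
  | sep => True
  | conc α β => α.Correct k rk ∧ β.Correct k rk ∧ α.rank rk + β.rank rk ≤ k
  | inter j α β => α.Correct k rk ∧ β.Correct k rk ∧ 1 ≤ j ∧ j ≤ k ∧ j ≤ α.rank rk ∧
      α.rank rk + β.rank rk ≤ k + 1

/-- Ground terms: no nonterminal occurs. -/
def Ground : Tm N σ → Prop
  | nt _ => False
  | word _ => True
  | sep => True
  | conc α β => α.Ground ∧ β.Ground
  | inter _ α β => α.Ground ∧ β.Ground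

/-- The value of a ground term (nonterminals, absent from ground terms, get a dummy value). -/
def value : Tm N σ → SepWord σ
  | nt _ => []
  | word w => w.map some
  | sep => [none]
  | conc α β => α.value ++ β.value
  | inter j α β => intercal j α.value β.value

end Tm

/-- Contexts: terms with exactly one occurrence of a hole, in a leaf position. -/
inductive Ctx (N σ : Type*) where
  | hole
  | concL (C : Ctx N σ) (β : Tm N σ)
  | concR (α : Tm N σ) (C : Ctx N σ)
  | interL (j : ℕ) (C : Ctx N σ) (β : Tm N σ)
  | interR (j : ℕ) (α : Tm N σ) (C : Ctx N σ)

/-- `C.plug γ` is the term `C[γ]`. -/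
def Ctx.plug {N σ : Type*} : Ctx N σ → Tm N σ → Tm N σ
  | hole, γ => γ
  | concL C β, γ => Tm.conc (C.plug γ) β
  | concR α C, γ => Tm.conc α (C.plug γ)
  | interL j C β, γ => Tm.inter j (C.plug γ) β
  | interR j α C, γ => Tm.inter j α (C.plug γ)

/-- `k`-displacement context-free grammars over the alphabet `σ`. A pair `(A, α)` in `rules`
is the rule `A → α`. -/
structure DCFG (k : ℕ) (σ : Type*) where
  /-- the nonterminals -/
  N : Type
  finite_N : Finite N
  rk : N → ℕ
  rk_le : ∀ A, rk A ≤ k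
  start : N
  rk_start : rk start = 0
  rules : Set (N × Tm N σ)
  finite_rules : rules.Finite
  correct_rules : ∀ r ∈ rules, r.2.Correct k rk
  rank_rules : ∀ r ∈ rules, r.2.rank rk = rk r.1

namespace DCFG

variable {k : ℕ} {σ : Type*}

/-- The derivability relation `A ⊢ α`. -/
inductive Derives (G : DCFG k σ) (A : G.N) : Tm G.N σ → Prop
  | refl : Derives G A (Tm.nt A)
  | step (C : Ctx G.N σ) (B : G.N) (β : Tm G.N σ) :
      Derives G A (C.plug (Tm.nt B)) → (B, β) ∈ G.rules → Derives G A (C.plug β)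

/-- The words (with separators) derivable from `A`: the values of the ground `k`-correct terms
derivable from `A`. -/
def derivable (G : DCFG k σ) (A : G.N) : Set (SepWord σ) :=
  {v | ∃ α : Tm G.N σ, G.Derives A α ∧ α.Correct k G.rk ∧ α.Ground ∧ α.value = v}

/-- The generated language. Since the start symbol has rank `0`, words derived from it
contain no separator. -/
def language (G : DCFG k σ) : Language σ :=
  {w : List σ | w.map some ∈ G.derivable G.start}

end DCFG

/-- `k`-displacement context-free languages. -/
def IsDCFL {σ : Type*} (k : ℕ) (L : Language σ) : Prop :=
  ∃ G : DCFG k σ, G.language = L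

/-- The concatenation `f 0 ⋯ f (l - 1)` of a finite sequence of words. -/
def cat {σ : Type*} {l : ℕ} (f : Fin l → List σ) : List σ :=
  (List.ofFn f).flatten

/-- The `p`-th power of a word. -/
def pow {σ : Type*} (w : List σ) (p : ℕ) : List σ :=
  (List.replicate p w).flatten

end Displacement

namespace Displacement

/-! ### Separators and the laws of intercalation -/

section Words

variable {σ : Type*}

/-- The number of separators of a word. -/
def seps (v : SepWord σ) : ℕ := v.countP Option.isNone

@[simp] theorem seps_nil : seps ([] : SepWord σ) = 0 := rfl

@[simp] theorem seps_cons_some (a : σ) (v : SepWord σ) : seps (some a :: v) = seps v := by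
  simp [seps]

@[simp] theorem seps_cons_none (v : SepWord σ) : seps (none :: v) = seps v + 1 := by
  simp [seps]

@[simp] theorem seps_append (u v : SepWord σ) : seps (u ++ v) = seps u + seps v := by
  simp [seps]

@[simp] theorem seps_map_some (w : List σ) : seps (w.map some) = 0 := by
  induction w with
  | nil => rfl
  | cons a w ih => simpa using ih

theorem exists_eq_map_some {v : SepWord σ} (h : seps v = 0) : ∃ w : List σ, v = w.map some := by
  induction v with
  | nil => exact ⟨[], rfl⟩
  | cons x v ih =>
    cases x with
    | none => simp at h
    | some a =>
      obtain ⟨w, rfl⟩ := ih (by simpa using h)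
      exact ⟨a :: w, rfl⟩

theorem exists_split {j : ℕ} {u : SepWord σ} (hj : 1 ≤ j) (h : j ≤ seps u) :
    ∃ a b : SepWord σ, u = a ++ none :: b ∧ seps a + 1 = j := by
  induction u generalizing j with
  | nil => simp at h; omega
  | cons x u ih =>
    cases x with
    | some c =>
      obtain ⟨a, b, rfl, hab⟩ := ih hj (by simpa using h)
      exact ⟨some c :: a, b, rfl, by simpa using hab⟩
    | none =>
      obtain rfl | hj' := hj.eq_or_lt
      · exact ⟨[], u, rfl, rfl⟩
      · obtain ⟨a, b, rfl, hab⟩ := ih (j := j - 1) (by omega) (by simp at h; omega)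
        exact ⟨none :: a, b, rfl, by simp; omega⟩

theorem exists_eq_of_seps_eq_one {v : SepWord σ} (h : seps v = 1) :
    ∃ a b : List σ, v = a.map some ++ none :: b.map some := by
  obtain ⟨a, b, rfl, hab⟩ := exists_split le_rfl h.ge
  obtain ⟨a, rfl⟩ := exists_eq_map_some (v := a) (by omega)
  obtain ⟨b, rfl⟩ := exists_eq_map_some (v := b) (by simpa using h)
  exact ⟨a, b, rfl⟩

/-- Together with `exists_split`, this reduces laws of intercalation to list concatenation. -/
theorem intercal_split (a b v : SepWord σ) :
    intercal (seps a + 1) (a ++ none :: b) v = a ++ v ++ b := by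
  induction a with
  | nil => simp [intercal]
  | cons x a ih => cases x <;> simpa [intercal] using ih

theorem intercal_split' {a b v : SepWord σ} {j : ℕ} (h : j = seps a + 1) :
    intercal j (a ++ none :: b) v = a ++ v ++ b := by
  rw [h, intercal_split]

theorem intercal_append_left {j : ℕ} {u : SepWord σ} (hj : 1 ≤ j) (h : j ≤ seps u)
    (t v : SepWord σ) : intercal j (u ++ t) v = intercal j u v ++ t := by
  obtain ⟨a, b, rfl, rfl⟩ := exists_split hj h
  rw [List.append_assoc, List.cons_append, intercal_split, intercal_split]
  simp

theorem intercal_append_right {j : ℕ} {u : SepWord σ} (h : seps u < j) (t v : SepWord σ) :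
    intercal j (u ++ t) v = u ++ intercal (j - seps u) t v := by
  induction u generalizing j with
  | nil => simp
  | cons x u ih =>
    cases x with
    | some c => simpa [intercal] using ih (by simpa using h)
    | none =>
      obtain ⟨i, rfl⟩ : ∃ i, j = i + 2 := ⟨j - 2, by simp at h; omega⟩
      have := ih (j := i + 1) (by simp at h; omega)
      simp only [List.cons_append, intercal, this, seps_cons_none]
      congr 3
      omega

theorem seps_intercal {j : ℕ} {u : SepWord σ} (hj : 1 ≤ j) (h : j ≤ seps u) (v : SepWord σ) :
    seps (intercal j u v) = seps u + seps v - 1 := by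
  obtain ⟨a, b, rfl, rfl⟩ := exists_split hj h
  rw [intercal_split]
  simp
  omega

theorem length_intercal {j : ℕ} {u : SepWord σ} (hj : 1 ≤ j) (h : j ≤ seps u) (v : SepWord σ) :
    (intercal j u v).length + 1 = u.length + v.length := by
  obtain ⟨a, b, rfl, rfl⟩ := exists_split hj h
  rw [intercal_split]
  simp
  omega

theorem length_intercal_le (j : ℕ) (u v : SepWord σ) :
    (intercal j u v).length ≤ u.length + v.length := by
  induction u generalizing j with
  | nil => simp [intercal]
  | cons x u ih =>
    cases x with
    | some c => have := ih j; simp [intercal]; omega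
    | none =>
      match j with
      | 0 => simp [intercal]
      | 1 => simp [intercal]; omega
      | j + 2 => have := ih (j + 1); simp [intercal]; omega

/-- Filling the earlier separator with `x` removes one separator and brings in none, whence `i - 1`.
-/
theorem intercal_intercal_of_lt {i j : ℕ} {u : SepWord σ} (hj : 1 ≤ j) (hji : j < i)
    (hi : i ≤ seps u) (v x : SepWord σ) (hx : seps x = 0) :
    intercal j (intercal i u v) x = intercal (i - 1) (intercal j u x) v := by
  obtain ⟨a, b, rfl, rfl⟩ := exists_split (hj.trans hji.le) hi
  obtain ⟨c, d, rfl, rfl⟩ := exists_split (u := a) hj (by omega)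
  rw [intercal_split]
  simp only [List.append_assoc, List.cons_append]
  rw [intercal_split, intercal_split]
  rw [show c ++ x ++ (d ++ none :: b) = (c ++ x ++ d) ++ none :: b by simp,
    intercal_split' (by simp; omega)]
  simp

theorem intercal_intercal_of_mem {i j : ℕ} {u v : SepWord σ} (hi : 1 ≤ i) (hiu : i ≤ seps u)
    (hij : i ≤ j) (hj : j < i + seps v) (x : SepWord σ) :
    intercal j (intercal i u v) x = intercal i u (intercal (j - i + 1) v x) := by
  obtain ⟨a, b, rfl, rfl⟩ := exists_split hi hiu
  obtain ⟨c, d, rfl, hc⟩ := exists_split (j := j - (seps a + 1) + 1) (u := v) (by omega) (by omega)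
  rw [intercal_split, intercal_split, ← hc, intercal_split,
    show a ++ (c ++ none :: d) ++ b = (a ++ c) ++ none :: (d ++ b) by simp,
    intercal_split' (by simp; omega)]
  simp

/-- The separator in question lies to the right of `v`. Inserting `v` trades one separator for `seps
v`, so its number in `u` is `j + 1 - seps v`. -/
theorem intercal_intercal_of_ge {i j : ℕ} {u v : SepWord σ} (hi : 1 ≤ i) (hiu : i ≤ seps u)
    (hij : i + seps v ≤ j) (hj : j ≤ seps u + seps v - 1) (x : SepWord σ) :
    intercal j (intercal i u v) x = intercal i (intercal (j + 1 - seps v) u x) v := by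
  obtain ⟨a, b, rfl, rfl⟩ := exists_split hi hiu
  simp only [seps_append, seps_cons_none] at hj
  obtain ⟨c, d, rfl, hc⟩ := exists_split (j := j - seps a - seps v) (u := b) (by omega) (by omega)
  rw [intercal_split, show a ++ v ++ (c ++ none :: d) = (a ++ v ++ c) ++ none :: d by simp,
    intercal_split' (by simp; omega),
    show a ++ none :: (c ++ none :: d) = (a ++ none :: c) ++ none :: d by simp,
    intercal_split' (by simp; omega),
    show a ++ none :: c ++ x ++ d = a ++ none :: (c ++ x ++ d) by simp, intercal_split]
  simp

end Words

/-! ### Even contexts -/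

section Wrap

variable {σ : Type*}

/-- `wrapTail z y x` inserts the words `z i` before and `y i` after the separators of `x`, and a
last word `z i` at the end. -/
def wrapTail : (ℕ → List σ) → (ℕ → List σ) → SepWord σ → SepWord σ
  | z, _, [] => (z 0).map some
  | z, y, some a :: x => some a :: wrapTail z y x
  | z, y, none :: x => (z 0).map some ++ none ::
      ((y 0).map some ++ wrapTail (fun i => z (i + 1)) (fun i => y (i + 1)) x)

/-- `wrap y z x` replaces the segments `x i` between the separators of `x` by
`y i ++ x i ++ z i`. -/
def wrap (y z : ℕ → List σ) (x : SepWord σ) : SepWord σ :=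
  (y 0).map some ++ wrapTail z (fun i => y (i + 1)) x

theorem wrapTail_map_some_append (z y : ℕ → List σ) (w : List σ) (x : SepWord σ) :
    wrapTail z y (w.map some ++ x) = w.map some ++ wrapTail z y x := by
  induction w with
  | nil => rfl
  | cons a w ih => simpa [wrapTail] using ih

theorem wrapTail_wrapTail (z y z' y' : ℕ → List σ) (x : SepWord σ) :
    wrapTail z y (wrapTail z' y' x) =
      wrapTail (fun i => z' i ++ z i) (fun i => y i ++ y' i) x := by
  induction x generalizing z y z' y' with
  | nil =>
    have := wrapTail_map_some_append z y (z' 0) []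
    simpa [wrapTail] using this
  | cons c x ih =>
    cases c with
    | some a => simp [wrapTail, ih]
    | none => simp [wrapTail, wrapTail_map_some_append, ih]

theorem wrap_wrap (y z y' z' : ℕ → List σ) (x : SepWord σ) :
    wrap y z (wrap y' z' x) = wrap (fun i => y i ++ y' i) (fun i => z' i ++ z i) x := by
  simp [wrap, wrapTail_map_some_append, wrapTail_wrapTail]

@[simp] theorem wrapTail_nil (x : SepWord σ) :
    wrapTail (fun _ => []) (fun _ => []) x = x := by
  induction x with
  | nil => rfl
  | cons c x ih => cases c <;> simp [wrapTail, ih]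

@[simp] theorem wrap_nil (x : SepWord σ) : wrap (fun _ => []) (fun _ => []) x = x := by
  simp [wrap]

theorem sublist_wrapTail (z y : ℕ → List σ) (x : SepWord σ) : x.Sublist (wrapTail z y x) := by
  induction x generalizing z y with
  | nil => simp
  | cons c x ih =>
    cases c with
    | some a => simpa [wrapTail] using ih z y
    | none =>
      refine List.Sublist.trans ?_ (List.sublist_append_right _ _)
      exact ((ih _ _).trans (List.sublist_append_right _ _)).cons_cons _

theorem sublist_wrap (y z : ℕ → List σ) (x : SepWord σ) : x.Sublist (wrap y z x) :=
  (sublist_wrapTail _ _ _).trans (List.sublist_append_right _ _)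

theorem append_eq_wrap_left (w : List σ) (x : SepWord σ) :
    w.map some ++ x = wrap (fun i => if i = 0 then w else []) (fun _ => []) x := by
  simp [wrap]

theorem append_eq_wrapTail (w : List σ) (x : SepWord σ) :
    x ++ w.map some = wrapTail (fun i => if i = seps x then w else []) (fun _ => []) x := by
  induction x with
  | nil => simp [wrapTail]
  | cons c x ih => cases c <;> simp [wrapTail, ih]

theorem append_eq_wrap_right (w : List σ) (x : SepWord σ) :
    x ++ w.map some = wrap (fun _ => []) (fun i => if i = seps x then w else []) x := by
  simpa [wrap] using append_eq_wrapTail w x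

theorem intercal_eq_wrapTail (d e : List σ) {j : ℕ} {x : SepWord σ} (hj : 1 ≤ j)
    (h : j ≤ seps x) : intercal j x (d.map some ++ none :: e.map some) =
      wrapTail (fun i => if i + 1 = j then d else []) (fun i => if i + 1 = j then e else []) x := by
  induction x generalizing j with
  | nil => simp at h; omega
  | cons c x ih =>
    cases c with
    | some a => simpa [wrapTail, intercal] using ih hj (by simpa using h)
    | none =>
      match j with
      | 1 => simp [wrapTail, intercal]
      | j + 2 =>
        have := ih (j := j + 1) (by omega) (by simpa using h)
        simpa [wrapTail, intercal] using this

/-- With segments numbered from 0, `d` lands at the end of segment `j - 1` and `e` at the start of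
segment `j`. So a right sibling of rank 1 acts as an even context. -/
theorem intercal_eq_wrap (d e : List σ) {j : ℕ} {x : SepWord σ} (hj : 1 ≤ j)
    (h : j ≤ seps x) : intercal j x (d.map some ++ none :: e.map some) =
      wrap (fun i => if i = j then e else []) (fun i => if i + 1 = j then d else []) x := by
  rw [wrap, if_neg (by omega), intercal_eq_wrapTail d e hj h]
  rfl

theorem pow_succ_left (w : List σ) (p : ℕ) : pow w (p + 1) = w ++ pow w p := by
  simp [pow, List.replicate_succ]

theorem pow_succ_right (w : List σ) (p : ℕ) : pow w (p + 1) = pow w p ++ w := by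
  simp [pow, List.replicate_succ']

@[simp] theorem pow_zero (w : List σ) : pow w 0 = [] := rfl

@[simp] theorem pow_one (w : List σ) : pow w 1 = w := by simp [pow]

theorem wrap_pow_succ (y z : ℕ → List σ) (p : ℕ) (x : SepWord σ) :
    wrap (fun i => pow (y i) (p + 1)) (fun i => pow (z i) (p + 1)) x =
      wrap y z (wrap (fun i => pow (y i) p) (fun i => pow (z i) p) x) := by
  rw [wrap_wrap]
  simp only [pow_succ_left (y _), pow_succ_right (z _)]

end Wrap

/-! ### Pumping families and their stability under contexts -/

section Pump

variable {σ : Type*}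

/-- `PumpFamily l b f`: the words `f p` have the form
`s₀ y₁ᵖ u₁ z₁ᵖ s₁ ⋯ yₗᵖ uₗ zₗᵖ sₗ`, where separators occur in the `sᵢ` only, and `b` is the total
length of the words `yᵢ uᵢ zᵢ`. -/
inductive PumpFamily : ℕ → ℕ → (ℕ → SepWord σ) → Prop
  | const (s : SepWord σ) : PumpFamily 0 0 fun _ => s
  | cons {l b : ℕ} {f : ℕ → SepWord σ} (s : SepWord σ) (y u z : List σ) :
      PumpFamily l b f → PumpFamily (l + 1) (y.length + u.length + z.length + b)
        fun p => s ++ ((pow y p ++ u ++ pow z p).map some ++ f p)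

namespace PumpFamily

variable {l b : ℕ} {f : ℕ → SepWord σ}

theorem prepend (h : PumpFamily l b f) (t : SepWord σ) : PumpFamily l b fun p => t ++ f p := by
  cases h with
  | const s => exact const (t ++ s)
  | cons s y u z h => simpa only [List.append_assoc] using cons (t ++ s) y u z h

theorem append (h : PumpFamily l b f) (t : SepWord σ) : PumpFamily l b fun p => f p ++ t := by
  induction h with
  | const s => exact const (s ++ t)
  | cons s y u z _ ih => simpa only [List.append_assoc] using cons s y u z ih

/-- The separators lie in the constant parts, so at most one of these changes, in the same way for
all `p`. -/
theorem intercal (h : PumpFamily l b f) {j : ℕ} (hj : 1 ≤ j) (v : SepWord σ) :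
    PumpFamily l b fun p => intercal j (f p) v := by
  induction h generalizing j with
  | const s => exact const (Displacement.intercal j s v)
  | cons s y u z h ih =>
    by_cases hs : j ≤ seps s
    · simpa only [intercal_append_left hj hs] using cons (Displacement.intercal j s v) y u z h
    · have hs' : ∀ w : List σ, seps (w.map some) < j - seps s := fun w => by
        rw [seps_map_some]; omega
      simpa only [intercal_append_right (not_le.1 hs), intercal_append_right (hs' _),
        seps_map_some, Nat.sub_zero] using cons s y u z (ih (j := j - seps s) (by omega))

theorem le_length (h : PumpFamily l b f) : b ≤ (f 1).length := by
  induction h with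
  | const s => simp
  | cons s y u z h ih => simp; omega

/-- The parameters `y` and `u` hold the left pumped word and the letters read so far of the current
segment; the next separator, or the end, closes the block. -/
theorem wrapTail (x : SepWord σ) (y u : List σ) (z y' : ℕ → List σ) :
    ∃ b, PumpFamily (seps x + 1) b fun p => (pow y p).map some ++ (u.map some ++
      wrapTail (fun i => pow (z i) p) (fun i => pow (y' i) p) x) := by
  induction x generalizing y u z y' with
  | nil =>
    refine ⟨y.length + u.length + (z 0).length + 0, ?_⟩
    simpa [Displacement.wrapTail] using cons [] y u (z 0) (const [])
  | cons c x ih =>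
    cases c with
    | some a =>
      obtain ⟨b, hb⟩ := ih y (u ++ [a]) z y'
      exact ⟨b, by simpa [Displacement.wrapTail] using hb⟩
    | none =>
      obtain ⟨b, hb⟩ := ih (y' 0) [] (fun i => z (i + 1)) (fun i => y' (i + 1))
      refine ⟨y.length + u.length + (z 0).length + b, ?_⟩
      simpa [Displacement.wrapTail] using cons [] y u (z 0) (hb.prepend [none])

theorem wrap (x : SepWord σ) (y z : ℕ → List σ) :
    ∃ b, PumpFamily (seps x + 1) b fun p =>
      wrap (fun i => pow (y i) p) (fun i => pow (z i) p) x := by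
  simpa [Displacement.wrap] using wrapTail x (y 0) [] z (fun i => y (i + 1))

end PumpFamily

/-- The word `v` can be pumped inside `L` in at most `m` places, of total length at most `B`. -/
def Pumpable (m : ℕ) (B : ℕ∞) (L : Set (SepWord σ)) (v : SepWord σ) : Prop :=
  ∃ l b f, PumpFamily l b f ∧ l ≤ m ∧ (b : ℕ∞) ≤ B ∧ f 1 = v ∧ (f 0).length < (f 1).length ∧
    ∀ p, f p ∈ L

namespace Pumpable

variable {m : ℕ} {B : ℕ∞} {L L' : Set (SepWord σ)} {v : SepWord σ}

theorem mono (h : Pumpable m B L v) {m' : ℕ} {B' : ℕ∞} (hm : m ≤ m') (hB : B ≤ B')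
    (hL : L ⊆ L') : Pumpable m' B' L' v := by
  obtain ⟨l, b, f, hf, hl, hb, h1, h01, h⟩ := h
  exact ⟨l, b, f, hf, hl.trans hm, hb.trans hB, h1, h01, fun p => hL (h p)⟩

theorem length_bound (h : Pumpable m B L v) : Pumpable m v.length L v := by
  obtain ⟨l, b, f, hf, hl, -, rfl, h01, h⟩ := h
  exact ⟨l, b, f, hf, hl, by exact_mod_cast hf.le_length, rfl, h01, h⟩

theorem prepend (h : Pumpable m B L v) (t : SepWord σ) (hL : ∀ x ∈ L, t ++ x ∈ L') :
    Pumpable m B L' (t ++ v) := by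
  obtain ⟨l, b, f, hf, hl, hb, rfl, h01, h⟩ := h
  exact ⟨l, b, _, hf.prepend t, hl, hb, rfl, by simpa using h01, fun p => hL _ (h p)⟩

theorem append (h : Pumpable m B L v) (t : SepWord σ) (hL : ∀ x ∈ L, x ++ t ∈ L') :
    Pumpable m B L' (v ++ t) := by
  obtain ⟨l, b, f, hf, hl, hb, rfl, h01, h⟩ := h
  exact ⟨l, b, _, hf.append t, hl, hb, rfl, by simpa using h01, fun p => hL _ (h p)⟩

theorem intercal_left (h : Pumpable m B L v) {j : ℕ} (hj : 1 ≤ j) (hL : ∀ x ∈ L, j ≤ seps x)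
    (t : SepWord σ) (hL' : ∀ x ∈ L, intercal j x t ∈ L') : Pumpable m B L' (intercal j v t) := by
  obtain ⟨l, b, f, hf, hl, hb, rfl, h01, h⟩ := h
  refine ⟨l, b, _, hf.intercal hj t, hl, hb, rfl, ?_, fun p => hL' _ (h p)⟩
  have h0 := length_intercal hj (hL _ (h 0)) t
  have h1 := length_intercal hj (hL _ (h 1)) t
  omega

theorem intercal_right (h : Pumpable m B L v) {j : ℕ} {t : SepWord σ} (hj : 1 ≤ j)
    (hjt : j ≤ seps t) (hL' : ∀ x ∈ L, intercal j t x ∈ L') :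
    Pumpable m B L' (intercal j t v) := by
  obtain ⟨a, b, rfl, rfl⟩ := exists_split hj hjt
  simp only [intercal_split] at hL' ⊢
  have := h.prepend (L' := (a ++ ·) '' L) a (fun x hx => ⟨x, hx, rfl⟩)
  refine this.append b ?_
  rintro _ ⟨x, hx, rfl⟩
  exact hL' x hx

/-- An even context that maps `L` into itself pumps, unless it is trivial. -/
theorem of_wrap {K : ℕ} {x : SepWord σ} (y z : ℕ → List σ) (hx : seps x = K)
    (hL : ∀ v ∈ L, Displacement.wrap y z v ∈ L) (hxL : x ∈ L)
    (hne : Displacement.wrap y z x ≠ x) : Pumpable (K + 1) ⊤ L (wrap y z x) := by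
  obtain ⟨b, hb⟩ := PumpFamily.wrap x y z
  refine ⟨_, b, _, hb, by omega, le_top, by simp, ?_, fun p => ?_⟩
  -- `x` is a sublist of `wrap y z x`, so without growth in length the two would coincide.
  · simp only [pow_zero, wrap_nil, pow_one]
    by_contra hlt
    exact hne ((sublist_wrap y z x).eq_of_length_le (not_lt.1 hlt)).symm
  · induction p with
    | zero => simpa using hxL
    | succ p ih => rw [wrap_pow_succ]; exact hL _ ih

end Pumpable

end Pump

/-! ### Values of terms and elimination of the top rank -/

section Terms

variable {N σ : Type*}

namespace Tm

/-- The set of values of a term, given the sets of values of the nonterminals. -/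
def eval (V : N → Set (SepWord σ)) : Tm N σ → Set (SepWord σ)
  | nt A => V A
  | word w => {w.map some}
  | sep => {[none]}
  | conc α β => Set.image2 (· ++ ·) (α.eval V) (β.eval V)
  | inter j α β => Set.image2 (intercal j) (α.eval V) (β.eval V)

/-- All operations of the term are defined, and all its subterms have rank less than `K`. -/
def Bounded (K : ℕ) (rk : N → ℕ) : Tm N σ → Prop
  | nt A => rk A < K
  | word _ => 0 < K
  | sep => 1 < K
  | conc α β => α.Bounded K rk ∧ β.Bounded K rk ∧ α.rank rk + β.rank rk < K
  | inter j α β => α.Bounded K rk ∧ β.Bounded K rk ∧ 1 ≤ j ∧ j ≤ α.rank rk ∧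
      α.rank rk + β.rank rk ≤ K

/-- The set of subterms of a term. -/
def subs : Tm N σ → Set (Tm N σ)
  | nt A => {nt A}
  | word w => {word w}
  | sep => {sep}
  | conc α β => insert (conc α β) (α.subs ∪ β.subs)
  | inter j α β => insert (inter j α β) (α.subs ∪ β.subs)

variable {K : ℕ} {rk : N → ℕ} {α β : Tm N σ} {j : ℕ}

theorem Bounded.rank_lt (h : α.Bounded K rk) : α.rank rk < K := by
  cases α with
  | nt A => exact h
  | word w => exact h
  | sep => exact h
  | conc α β => exact h.2.2
  | inter j α β =>
    obtain ⟨-, -, h1, h2, h3⟩ := h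
    simp only [rank]
    omega

theorem seps_of_mem_eval {V : N → Set (SepWord σ)} (hV : ∀ A, ∀ v ∈ V A, seps v = rk A)
    (h : α.Bounded K rk) {v : SepWord σ} (hv : v ∈ α.eval V) : seps v = α.rank rk := by
  induction α generalizing v with
  | nt A => exact hV A v hv
  | word w => rw [show v = w.map some from hv]; exact seps_map_some w
  | sep => rw [show v = [none] from hv]; rfl
  | conc α β iha ihb =>
    obtain ⟨a, ha, b, hb, rfl⟩ := hv
    simp only [seps_append, iha h.1 ha, ihb h.2.1 hb, rank]
  | inter j α β iha ihb =>
    obtain ⟨a, ha, b, hb, rfl⟩ := hv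
    obtain ⟨h1, h2, h3, h4, -⟩ := h
    rw [seps_intercal h3 (by rw [iha h1 ha]; exact h4), iha h1 ha, ihb h2 hb, rank]

/-- `α` and `β` have the same values, provided that the nonterminals have values of the right
rank. -/
def Equivalent (rk : N → ℕ) (α β : Tm N σ) : Prop :=
  α.rank rk = β.rank rk ∧
    ∀ V : N → Set (SepWord σ), (∀ A, ∀ v ∈ V A, seps v = rk A) → α.eval V = β.eval V

/-- The second claim strengthens the induction: `α` may have rank `K`, and the rank 0 term `β` is
pushed through its operations down to a leaf, so that no subterm of rank `K` remains. -/
theorem exists_bounded_equivalent_aux (hrk : ∀ A, rk A < K) (hα : α.Bounded (K + 1) rk) :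
    (α.rank rk < K → ∃ γ : Tm N σ, γ.Bounded K rk ∧ γ.Equivalent rk α) ∧
    ∀ j β, 1 ≤ j → j ≤ α.rank rk → β.Bounded K rk → β.rank rk = 0 →
      ∃ γ : Tm N σ, γ.Bounded K rk ∧ γ.Equivalent rk (inter j α β) := by
  induction α with
  | nt A =>
    refine ⟨fun h => ⟨nt A, h, rfl, fun _ _ => rfl⟩, fun j β hj hjA hβ h0 => ?_⟩
    refine ⟨inter j (nt A) β, ⟨hrk A, hβ, hj, hjA, ?_⟩, rfl, fun _ _ => rfl⟩
    rw [h0]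
    exact (hrk A).le
  | word w =>
    refine ⟨fun h => ⟨word w, h, rfl, fun _ _ => rfl⟩, fun j β hj hjA hβ h0 => ?_⟩
    simp only [rank] at hjA
    omega
  | sep =>
    refine ⟨fun h => ⟨sep, h, rfl, fun _ _ => rfl⟩, fun j β hj hjA hβ h0 => ?_⟩
    obtain rfl : j = 1 := le_antisymm hjA hj
    refine ⟨β, hβ, by simp [rank, h0], fun V hV => ?_⟩
    simp [eval, intercal]
  | conc α₁ α₂ ih₁ ih₂ =>
    obtain ⟨hb₁, hb₂, hr⟩ := hα
    obtain ⟨ih₁, ih₁'⟩ := ih₁ hb₁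
    obtain ⟨ih₂, ih₂'⟩ := ih₂ hb₂
    simp only [rank]
    refine ⟨fun h => ?_, fun j β hj hjA hβ h0 => ?_⟩
    · obtain ⟨γ₁, hγ₁, hr₁, he₁⟩ := ih₁ (by omega)
      obtain ⟨γ₂, hγ₂, hr₂, he₂⟩ := ih₂ (by omega)
      refine ⟨conc γ₁ γ₂, ⟨hγ₁, hγ₂, by omega⟩, by simp only [rank, hr₁, hr₂], fun V hV => ?_⟩
      simp only [eval, he₁ V hV, he₂ V hV]
    · by_cases hj₁ : j ≤ α₁.rank rk
      · obtain ⟨γ₁, hγ₁, hr₁, he₁⟩ := ih₁' j β hj hj₁ hβ h0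
        obtain ⟨γ₂, hγ₂, hr₂, he₂⟩ := ih₂ (by omega)
        simp only [rank] at hr₁
        refine ⟨conc γ₁ γ₂, ⟨hγ₁, hγ₂, by omega⟩, by simp only [rank]; omega, fun V hV => ?_⟩
        simp only [eval, he₁ V hV, he₂ V hV]
        ext x
        constructor
        · rintro ⟨_, ⟨a, ha, b, hb, rfl⟩, c, hc, rfl⟩
          refine ⟨_, ⟨a, ha, c, hc, rfl⟩, b, hb, ?_⟩
          exact intercal_append_left hj (by rwa [seps_of_mem_eval hV hb₁ ha]) _ _
        · rintro ⟨_, ⟨a, ha, c, hc, rfl⟩, b, hb, rfl⟩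
          refine ⟨_, ⟨a, ha, b, hb, rfl⟩, c, hc, ?_⟩
          exact (intercal_append_left hj (by rwa [seps_of_mem_eval hV hb₁ ha]) _ _).symm
      · obtain ⟨γ₁, hγ₁, hr₁, he₁⟩ := ih₁ (by omega)
        obtain ⟨γ₂, hγ₂, hr₂, he₂⟩ := ih₂' (j - α₁.rank rk) β (by omega) (by omega) hβ h0
        simp only [rank] at hr₂
        refine ⟨conc γ₁ γ₂, ⟨hγ₁, hγ₂, by omega⟩, by simp only [rank]; omega, fun V hV => ?_⟩
        simp only [eval, he₁ V hV, he₂ V hV]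
        have key : ∀ a ∈ α₁.eval V, ∀ c b, intercal j (a ++ c) b =
            a ++ intercal (j - α₁.rank rk) c b := fun a ha c b => by
          have := seps_of_mem_eval hV hb₁ ha
          rw [intercal_append_right (by omega), this]
        ext x
        constructor
        · rintro ⟨a, ha, _, ⟨c, hc, b, hb, rfl⟩, rfl⟩
          exact ⟨_, ⟨a, ha, c, hc, rfl⟩, b, hb, key a ha c b⟩
        · rintro ⟨_, ⟨a, ha, c, hc, rfl⟩, b, hb, rfl⟩
          exact ⟨a, ha, _, ⟨c, hc, b, hb, rfl⟩, (key a ha c b).symm⟩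
  | inter i α₁ α₂ ih₁ ih₂ =>
    obtain ⟨hb₁, hb₂, hi, hi₁, hr⟩ := hα
    obtain ⟨ih₁, ih₁'⟩ := ih₁ hb₁
    obtain ⟨ih₂, ih₂'⟩ := ih₂ hb₂
    simp only [rank]
    refine ⟨fun h => ?_, fun j β hj hjA hβ h0 => ?_⟩
    · obtain ⟨γ₂, hγ₂, hr₂, he₂⟩ := ih₂ (by omega)
      -- Only for `α₂` of rank 0 can `α₁` have rank `K`; then `α₂` is pushed into `α₁`.
      by_cases h₂ : α₂.rank rk = 0
      · obtain ⟨γ, hγ, hrγ, heγ⟩ := ih₁' i γ₂ hi hi₁ hγ₂ (by omega)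
        refine ⟨γ, hγ, by simpa only [rank, hr₂] using hrγ, fun V hV => ?_⟩
        simp only [eval, heγ V hV, he₂ V hV]
      · obtain ⟨γ₁, hγ₁, hr₁, he₁⟩ := ih₁ (by omega)
        refine ⟨inter i γ₁ γ₂, ⟨hγ₁, hγ₂, hi, by omega, by omega⟩,
          by simp only [rank, hr₁, hr₂], fun V hV => ?_⟩
        simp only [eval, he₁ V hV, he₂ V hV]
    · have seps₁ : ∀ {V : N → Set (SepWord σ)}, (∀ A, ∀ v ∈ V A, seps v = rk A) →
          ∀ a ∈ α₁.eval V, seps a = α₁.rank rk := fun hV a ha => seps_of_mem_eval hV hb₁ ha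
      have seps₂ : ∀ {V : N → Set (SepWord σ)}, (∀ A, ∀ v ∈ V A, seps v = rk A) →
          ∀ a ∈ α₂.eval V, seps a = α₂.rank rk := fun hV a ha => seps_of_mem_eval hV hb₂ ha
      have seps₃ : ∀ {V : N → Set (SepWord σ)}, (∀ A, ∀ v ∈ V A, seps v = rk A) →
          ∀ b ∈ β.eval V, seps b = 0 := fun hV a ha => h0 ▸ seps_of_mem_eval hV hβ ha
      -- The separator to be filled lies in `α₁` before the inserted word, inside that word, or in
      -- `α₁` after it.
      obtain hji | hij := lt_or_ge j i
      · obtain ⟨γ₁, hγ₁, hr₁, he₁⟩ := ih₁' j β hj (by omega) hβ h0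
        obtain ⟨γ₂, hγ₂, hr₂, he₂⟩ := ih₂ (by omega)
        simp only [rank] at hr₁
        refine ⟨inter (i - 1) γ₁ γ₂, ⟨hγ₁, hγ₂, by omega, by omega, by omega⟩,
          by simp only [rank]; omega, fun V hV => ?_⟩
        have key : ∀ a ∈ α₁.eval V, ∀ c, ∀ b ∈ β.eval V, intercal j (intercal i a c) b =
            intercal (i - 1) (intercal j a b) c := fun a ha c b hb =>
          intercal_intercal_of_lt hj hji (by rwa [seps₁ hV a ha]) _ _ (seps₃ hV b hb)
        simp only [eval, he₁ V hV, he₂ V hV]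
        ext x
        constructor
        · rintro ⟨_, ⟨a, ha, b, hb, rfl⟩, c, hc, rfl⟩
          exact ⟨_, ⟨a, ha, c, hc, rfl⟩, b, hb, key a ha c b hb⟩
        · rintro ⟨_, ⟨a, ha, c, hc, rfl⟩, b, hb, rfl⟩
          exact ⟨_, ⟨a, ha, b, hb, rfl⟩, c, hc, (key a ha c b hb).symm⟩
      · obtain hj₂ | hj₂ := lt_or_ge j (i + α₂.rank rk)
        · obtain ⟨γ₂, hγ₂, hr₂, he₂⟩ := ih₂' (j - i + 1) β (by omega) (by omega) hβ h0
          simp only [rank] at hr₂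
          have key : ∀ V : N → Set (SepWord σ), (∀ A, ∀ v ∈ V A, seps v = rk A) →
              Set.image2 (intercal i) (α₁.eval V) (γ₂.eval V) =
                (inter j (inter i α₁ α₂) β).eval V := fun V hV => by
            have key : ∀ a ∈ α₁.eval V, ∀ c ∈ α₂.eval V, ∀ b, intercal j (intercal i a c) b =
                intercal i a (intercal (j - i + 1) c b) := fun a ha c hc b =>
              intercal_intercal_of_mem hi (by rwa [seps₁ hV a ha]) hij
                (by rwa [seps₂ hV c hc]) _
            simp only [eval, he₂ V hV]
            ext x
            constructor
            · rintro ⟨a, ha, _, ⟨c, hc, b, hb, rfl⟩, rfl⟩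
              exact ⟨_, ⟨a, ha, c, hc, rfl⟩, b, hb, key a ha c hc b⟩
            · rintro ⟨_, ⟨a, ha, c, hc, rfl⟩, b, hb, rfl⟩
              exact ⟨a, ha, _, ⟨c, hc, b, hb, rfl⟩, (key a ha c hc b).symm⟩
          -- Filling the only separator of `α₂` leaves rank 0, and then `α₁` may have rank `K`, so
          -- the result is pushed on into `α₁`.
          by_cases h₂ : γ₂.rank rk = 0
          · obtain ⟨γ, hγ, hrγ, heγ⟩ := ih₁' i γ₂ hi hi₁ hγ₂ h₂
            simp only [rank] at hrγ
            refine ⟨γ, hγ, by simp only [rank]; omega, fun V hV => ?_⟩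
            rw [← key V hV, heγ V hV, eval]
          · obtain ⟨γ₁, hγ₁, hr₁, he₁⟩ := ih₁ (by omega)
            refine ⟨inter i γ₁ γ₂, ⟨hγ₁, hγ₂, hi, by omega, by omega⟩,
              by simp only [rank]; omega, fun V hV => ?_⟩
            rw [← key V hV, eval, he₁ V hV]
        · obtain ⟨γ₁, hγ₁, hr₁, he₁⟩ :=
            ih₁' (j + 1 - α₂.rank rk) β (by omega) (by omega) hβ h0
          obtain ⟨γ₂, hγ₂, hr₂, he₂⟩ := ih₂ (by omega)
          simp only [rank] at hr₁
          refine ⟨inter i γ₁ γ₂, ⟨hγ₁, hγ₂, by omega, by omega, by omega⟩,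
            by simp only [rank]; omega, fun V hV => ?_⟩
          have key : ∀ a ∈ α₁.eval V, ∀ c ∈ α₂.eval V, ∀ b, intercal j (intercal i a c) b =
              intercal i (intercal (j + 1 - α₂.rank rk) a b) c := fun a ha c hc b => by
            have h₁ := seps₁ hV a ha
            have h₂ := seps₂ hV c hc
            rw [intercal_intercal_of_ge hi (by omega) (by omega) (by omega), h₂]
          simp only [eval, he₁ V hV, he₂ V hV]
          ext x
          constructor
          · rintro ⟨_, ⟨a, ha, b, hb, rfl⟩, c, hc, rfl⟩
            exact ⟨_, ⟨a, ha, c, hc, rfl⟩, b, hb, key a ha c hc b⟩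
          · rintro ⟨_, ⟨a, ha, c, hc, rfl⟩, b, hb, rfl⟩
            exact ⟨_, ⟨a, ha, b, hb, rfl⟩, c, hc, (key a ha c hc b).symm⟩

/-- If the nonterminals and a term have rank less than `K`, then the subterms of rank `K` can be
eliminated from the term. -/
theorem exists_bounded_equivalent (hrk : ∀ A, rk A < K) (hα : α.Bounded (K + 1) rk)
    (h : α.rank rk < K) : ∃ γ : Tm N σ, γ.Bounded K rk ∧ γ.Equivalent rk α :=
  (exists_bounded_equivalent_aux hrk hα).1 h

theorem self_mem_subs (α : Tm N σ) : α ∈ α.subs := by cases α <;> simp [subs]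

theorem subs_subset (h : α ∈ β.subs) : α.subs ⊆ β.subs := by
  induction β with
  | nt A => rw [show α = nt A from h]
  | word w => rw [show α = word w from h]
  | sep => rw [show α = sep from h]
  | conc β₁ β₂ ih₁ ih₂ =>
    obtain rfl | h | h := h
    · exact subset_rfl
    · exact (ih₁ h).trans fun x hx => Or.inr (Or.inl hx)
    · exact (ih₂ h).trans fun x hx => Or.inr (Or.inr hx)
  | inter j β₁ β₂ ih₁ ih₂ =>
    obtain rfl | h | h := h
    · exact subset_rfl
    · exact (ih₁ h).trans fun x hx => Or.inr (Or.inl hx)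
    · exact (ih₂ h).trans fun x hx => Or.inr (Or.inr hx)

theorem finite_subs (α : Tm N σ) : α.subs.Finite := by
  induction α with
  | nt A => exact Set.finite_singleton _
  | word w => exact Set.finite_singleton _
  | sep => exact Set.finite_singleton _
  | conc α β iha ihb => exact (iha.union ihb).insert _
  | inter j α β iha ihb => exact (iha.union ihb).insert _

theorem Bounded.of_mem_subs (hβ : β.Bounded K rk) (h : α ∈ β.subs) : α.Bounded K rk := by
  induction β with
  | nt A => rwa [show α = nt A from h]
  | word w => rwa [show α = word w from h]
  | sep => rwa [show α = sep from h]
  | conc β₁ β₂ ih₁ ih₂ =>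
    obtain rfl | h | h := h
    · exact hβ
    · exact ih₁ hβ.1 h
    · exact ih₂ hβ.2.1 h
  | inter j β₁ β₂ ih₁ ih₂ =>
    obtain rfl | h | h := h
    · exact hβ
    · exact ih₁ hβ.1 h
    · exact ih₂ hβ.2.1 h

end Tm

/-! ### Derivations and closed systems -/

/-- `DerN R n τ v`: the term `τ` derives the word `v` by the rules `R`, with a derivation of
size `n`. -/
inductive DerN (R : Set (N × Tm N σ)) : ℕ → Tm N σ → SepWord σ → Prop
  | nt {n A β v} : (A, β) ∈ R → DerN R n β v → DerN R (n + 1) (Tm.nt A) v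
  | word w : DerN R 0 (Tm.word w) (w.map some)
  | sep : DerN R 0 Tm.sep [none]
  | conc {m n α β u v} : DerN R m α u → DerN R n β v →
      DerN R (m + n + 1) (Tm.conc α β) (u ++ v)
  | inter {m n j α β u v} : DerN R m α u → DerN R n β v →
      DerN R (m + n + 1) (Tm.inter j α β) (intercal j u v)

/-- The set of words that a term derives by the rules `R`. -/
def lang (R : Set (N × Tm N σ)) (τ : Tm N σ) : Set (SepWord σ) := {v | ∃ n, DerN R n τ v}

theorem mem_lang_nt {R : Set (N × Tm N σ)} {A : N} {v : SepWord σ} :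
    v ∈ lang R (Tm.nt A) ↔ ∃ β, (A, β) ∈ R ∧ v ∈ lang R β := by
  constructor
  · rintro ⟨_, h⟩
    cases h with
    | nt h h' => exact ⟨_, h, _, h'⟩
  · rintro ⟨β, h, n, h'⟩
    exact ⟨_, .nt h h'⟩

theorem conc_mem_lang {R : Set (N × Tm N σ)} {α β : Tm N σ} {u v : SepWord σ}
    (hu : u ∈ lang R α) (hv : v ∈ lang R β) : u ++ v ∈ lang R (Tm.conc α β) := by
  obtain ⟨m, hu⟩ := hu
  obtain ⟨n, hv⟩ := hv
  exact ⟨_, .conc hu hv⟩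

theorem inter_mem_lang {R : Set (N × Tm N σ)} {α β : Tm N σ} {u v : SepWord σ} {j : ℕ}
    (hu : u ∈ lang R α) (hv : v ∈ lang R β) : intercal j u v ∈ lang R (Tm.inter j α β) := by
  obtain ⟨m, hu⟩ := hu
  obtain ⟨n, hv⟩ := hv
  exact ⟨_, .inter hu hv⟩

theorem lang_eq_eval (R : Set (N × Tm N σ)) (τ : Tm N σ) :
    lang R τ = τ.eval fun A => lang R (Tm.nt A) := by
  ext v
  constructor
  · rintro ⟨n, h⟩
    induction h with
    | nt h h' => exact ⟨_, .nt h h'⟩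
    | word w => exact rfl
    | sep => exact rfl
    | conc _ _ ih₁ ih₂ => exact ⟨_, ih₁, _, ih₂, rfl⟩
    | inter _ _ ih₁ ih₂ => exact ⟨_, ih₁, _, ih₂, rfl⟩
  · intro h
    induction τ generalizing v with
    | nt A => exact h
    | word w => rw [show v = w.map some from h]; exact ⟨0, .word w⟩
    | sep => rw [show v = [none] from h]; exact ⟨0, .sep⟩
    | conc α β iha ihb =>
      obtain ⟨a, ha, b, hb, rfl⟩ := h
      exact conc_mem_lang (iha a ha) (ihb b hb)
    | inter j α β iha ihb =>
      obtain ⟨a, ha, b, hb, rfl⟩ := h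
      exact inter_mem_lang (iha a ha) (ihb b hb)

/-- The derivable words satisfy any valuation of the nonterminals that is closed under the
rules. -/
theorem lang_subset_eval {R : Set (N × Tm N σ)} {V : N → Set (SepWord σ)}
    (hV : ∀ A β, (A, β) ∈ R → β.eval V ⊆ V A) (τ : Tm N σ) : lang R τ ⊆ τ.eval V := by
  rintro v ⟨n, h⟩
  induction h with
  | nt h _ ih => exact hV _ _ h ih
  | word w => exact rfl
  | sep => exact rfl
  | conc _ _ ih₁ ih₂ => exact ⟨_, ih₁, _, ih₂, rfl⟩
  | inter _ _ ih₁ ih₂ => exact ⟨_, ih₁, _, ih₂, rfl⟩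

/-- `S` is a finite set of terms that is closed under taking subterms and applying rules, in
which all terms are rank-correct of rank less than `K`. -/
structure ClosedSystem (K : ℕ) (rk : N → ℕ) (R : Set (N × Tm N σ)) (S : Set (Tm N σ)) :
    Prop where
  finite : S.Finite
  bounded : ∀ τ ∈ S, τ.Bounded K rk
  conc : ∀ α β, Tm.conc α β ∈ S → α ∈ S ∧ β ∈ S
  inter : ∀ j α β, Tm.inter j α β ∈ S → α ∈ S ∧ β ∈ S
  nt : ∀ A β, Tm.nt A ∈ S → (A, β) ∈ R → β ∈ S ∧ β.rank rk = rk A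

theorem ClosedSystem.seps_of_mem_lang {K : ℕ} {rk : N → ℕ} {R : Set (N × Tm N σ)}
    {S : Set (Tm N σ)} (hS : ClosedSystem K rk R S) {τ : Tm N σ} (hτ : τ ∈ S) {v : SepWord σ}
    (hv : v ∈ lang R τ) : seps v = τ.rank rk := by
  obtain ⟨n, hv⟩ := hv
  induction hv with
  | nt h _ ih =>
    obtain ⟨h₁, h₂⟩ := hS.nt _ _ hτ h
    rw [ih h₁, h₂, Tm.rank]
  | word w => exact seps_map_some w
  | sep => rfl
  | conc _ _ ih₁ ih₂ =>
    obtain ⟨h₁, h₂⟩ := hS.conc _ _ hτ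
    rw [seps_append, ih₁ h₁, ih₂ h₂, Tm.rank]
  | inter _ _ ih₁ ih₂ =>
    obtain ⟨h₁, h₂⟩ := hS.inter _ _ _ hτ
    obtain ⟨-, -, h3, h4, -⟩ := hS.bounded _ hτ
    rw [seps_intercal h3 (by rwa [ih₁ h₁]), ih₁ h₁, ih₂ h₂, Tm.rank]

/-- The nonterminals and all subterms of right-hand sides form such a set. -/
theorem exists_closedSystem [Finite N] {K : ℕ} {rk : N → ℕ} {R : Set (N × Tm N σ)}
    (hR : R.Finite) (hrk : ∀ A, rk A < K) (hb : ∀ r ∈ R, r.2.Bounded K rk)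
    (hr : ∀ r ∈ R, r.2.rank rk = rk r.1) :
    ∃ S, ClosedSystem K rk R S ∧ ∀ A, Tm.nt A ∈ S := by
  have hsub : ∀ α β, α ∈ β.subs →
      β ∈ Set.range Tm.nt ∪ ⋃ r ∈ R, r.2.subs → α ∈ Set.range Tm.nt ∪ ⋃ r ∈ R, r.2.subs := by
    rintro α β hα (⟨A, rfl⟩ | hβ)
    · exact Or.inl ⟨A, (show α = Tm.nt A from hα).symm⟩
    · simp only [Set.mem_iUnion] at hβ
      obtain ⟨r, hr, hβ⟩ := hβ
      exact Or.inr (Set.mem_biUnion hr (Tm.subs_subset hβ hα))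
  refine ⟨Set.range Tm.nt ∪ ⋃ r ∈ R, r.2.subs, ⟨?_, ?_, ?_, ?_, ?_⟩, fun A => Or.inl ⟨A, rfl⟩⟩
  · exact (Set.finite_range _).union (hR.biUnion fun r _ => r.2.finite_subs)
  · rintro τ (⟨A, rfl⟩ | hτ)
    · exact hrk A
    · simp only [Set.mem_iUnion] at hτ
      obtain ⟨r, hr, hτ⟩ := hτ
      exact (hb r hr).of_mem_subs hτ
  · exact fun α β h => ⟨hsub α (.conc α β) (Or.inr (Or.inl α.self_mem_subs)) h,
      hsub β (.conc α β) (Or.inr (Or.inr β.self_mem_subs)) h⟩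
  · exact fun j α β h => ⟨hsub α (.inter j α β) (Or.inr (Or.inl α.self_mem_subs)) h,
      hsub β (.inter j α β) (Or.inr (Or.inr β.self_mem_subs)) h⟩
  · exact fun A β _ h => ⟨Or.inr (Set.mem_biUnion h β.self_mem_subs), hr _ h⟩

end Terms

/-! ### Unfolding down to terms of lower rank -/

section Expansion

universe u v

variable {N : Type u} {σ : Type v}

/-- Unfold the topmost operation or nonterminal of a term, and treat its children by `F`. -/
def expandStep {N' : Type*} (R : Set (N × Tm N σ)) (F : Tm N σ → Set (Tm N' σ)) :
    Tm N σ → Set (Tm N' σ)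
  | .nt A => ⋃ β ∈ {β | (A, β) ∈ R}, F β
  | .word w => {.word w}
  | .sep => {.sep}
  | .conc α β => Set.image2 .conc (F α) (F β)
  | .inter j α β => Set.image2 (.inter j) (F α) (F β)

/-- The terms of `S` of rank less than `K`, as new nonterminals. -/
abbrev LowTm (K : ℕ) (rk : N → ℕ) (S : Set (Tm N σ)) : Type max u v :=
  {τ : Tm N σ // τ ∈ S ∧ τ.rank rk < K}

/-- The ranks of the new nonterminals. -/
abbrev LowTm.rank {K : ℕ} {rk : N → ℕ} {S : Set (Tm N σ)} (τ : LowTm K rk S) : ℕ := τ.1.rank rk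

open Classical in
/-- Unfold a term, down to terms of rank less than `K` and at most to depth `d`. -/
def expand (K : ℕ) (rk : N → ℕ) (R : Set (N × Tm N σ)) (S : Set (Tm N σ)) :
    ℕ → Tm N σ → Set (Tm (LowTm K rk S) σ)
  | 0, τ => if h : τ ∈ S ∧ τ.rank rk < K then {.nt ⟨τ, h⟩} else ∅
  | d + 1, τ => if h : τ ∈ S ∧ τ.rank rk < K then {.nt ⟨τ, h⟩}
      else expandStep R (expand K rk R S d) τ

variable {K : ℕ} {rk : N → ℕ} {R : Set (N × Tm N σ)} {S : Set (Tm N σ)}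

theorem expand_of_lt {d : ℕ} {τ : Tm N σ} (h : τ ∈ S ∧ τ.rank rk < K) :
    expand K rk R S d τ = {.nt ⟨τ, h⟩} := by
  cases d <;> simp only [expand, dif_pos h]

theorem expand_succ_of_not_lt {d : ℕ} {τ : Tm N σ} (h : ¬ τ.rank rk < K) :
    expand K rk R S (d + 1) τ = expandStep R (expand K rk R S d) τ := by
  simp only [expand, dif_neg (fun h' : τ ∈ S ∧ _ => h h'.2)]

theorem expand_induction {P : Tm N σ → Set (Tm (LowTm K rk S) σ) → Prop}
    (hlow : ∀ τ (h : τ ∈ S ∧ τ.rank rk < K), P τ {.nt ⟨τ, h⟩}) (hempty : ∀ τ, P τ ∅)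
    (hstep : ∀ F, (∀ τ ∈ S, P τ (F τ)) → ∀ τ ∈ S, P τ (expandStep R F τ)) (d : ℕ) :
    ∀ τ ∈ S, P τ (expand K rk R S d τ) := by
  induction d with
  | zero =>
    intro τ _
    by_cases h : τ ∈ S ∧ τ.rank rk < K
    · rw [expand_of_lt h]; exact hlow τ h
    · rw [expand, dif_neg h]; exact hempty τ
  | succ d ih =>
    intro τ hτ
    by_cases h : τ.rank rk < K
    · rw [expand_of_lt ⟨hτ, h⟩]; exact hlow τ _
    · rw [expand_succ_of_not_lt h]; exact hstep _ ih τ hτ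

theorem ClosedSystem.finite_expandStep {N' : Type*} {k : ℕ} (hS : ClosedSystem k rk R S)
    (F : Tm N σ → Set (Tm N' σ)) (hF : ∀ τ ∈ S, (F τ).Finite) :
    ∀ τ ∈ S, (expandStep R F τ).Finite := by
  intro τ hτ
  cases τ with
  | nt A =>
    refine Set.Finite.biUnion (hS.finite.subset fun β hβ => (hS.nt _ _ hτ hβ).1) ?_
    exact fun β hβ => hF _ (hS.nt _ _ hτ hβ).1
  | word w => exact Set.finite_singleton _
  | sep => exact Set.finite_singleton _
  | conc α β => exact (hF _ (hS.conc _ _ hτ).1).image2 _ (hF _ (hS.conc _ _ hτ).2)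
  | inter j α β => exact (hF _ (hS.inter _ _ _ hτ).1).image2 _ (hF _ (hS.inter _ _ _ hτ).2)

theorem ClosedSystem.finite_expand {k : ℕ} (hS : ClosedSystem k rk R S) (d : ℕ) :
    ∀ τ ∈ S, (expand K rk R S d τ).Finite :=
  expand_induction (P := fun _ E => E.Finite) (fun _ _ => Set.finite_singleton _)
    (fun _ => Set.finite_empty) (fun F hF => hS.finite_expandStep F hF) d

/-- The term `e` is well formed, has the rank of `τ`, and derives only words derived by `τ`. -/
def Sound (K : ℕ) (rk : N → ℕ) (R : Set (N × Tm N σ)) (S : Set (Tm N σ)) (τ : Tm N σ)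
    (e : Tm (LowTm K rk S) σ) : Prop :=
  e.Bounded (K + 1) LowTm.rank ∧ e.rank LowTm.rank = τ.rank rk ∧
    e.eval (fun A => lang R A.1) ⊆ lang R τ

theorem ClosedSystem.sound_expandStep (hS : ClosedSystem (K + 1) rk R S)
    (F : Tm N σ → Set (Tm (LowTm K rk S) σ)) (hF : ∀ τ ∈ S, ∀ e ∈ F τ, Sound K rk R S τ e) :
    ∀ τ ∈ S, ∀ e ∈ expandStep R F τ, Sound K rk R S τ e := by
  intro τ hτ e he
  have hb := hS.bounded τ hτ
  cases τ with
  | nt A =>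
    simp only [expandStep, Set.mem_iUnion] at he
    obtain ⟨β, hβ, he⟩ := he
    obtain ⟨hβS, hβr⟩ := hS.nt _ _ hτ hβ
    obtain ⟨h1, h2, h3⟩ := hF β hβS e he
    exact ⟨h1, h2.trans hβr, fun v hv => mem_lang_nt.2 ⟨β, hβ, h3 hv⟩⟩
  | word w =>
    obtain rfl : e = .word w := he
    exact ⟨Nat.succ_pos K, rfl, by rintro _ rfl; exact ⟨0, .word w⟩⟩
  | sep =>
    obtain rfl : e = .sep := he
    exact ⟨hb, rfl, by rintro _ rfl; exact ⟨0, .sep⟩⟩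
  | conc α β =>
    obtain ⟨e₁, he₁, e₂, he₂, rfl⟩ := he
    obtain ⟨hα, hβ⟩ := hS.conc _ _ hτ
    obtain ⟨h1, h2, h3⟩ := hF α hα e₁ he₁
    obtain ⟨h1', h2', h3'⟩ := hF β hβ e₂ he₂
    refine ⟨⟨h1, h1', by rw [h2, h2']; exact hb.2.2⟩, by simp only [Tm.rank, h2, h2'], ?_⟩
    rintro _ ⟨a, ha, b, hb, rfl⟩
    exact conc_mem_lang (h3 ha) (h3' hb)
  | inter j α β =>
    obtain ⟨e₁, he₁, e₂, he₂, rfl⟩ := he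
    obtain ⟨hα, hβ⟩ := hS.inter _ _ _ hτ
    obtain ⟨h1, h2, h3⟩ := hF α hα e₁ he₁
    obtain ⟨h1', h2', h3'⟩ := hF β hβ e₂ he₂
    refine ⟨⟨h1, h1', hb.2.2.1, by rw [h2]; exact hb.2.2.2.1, by rw [h2, h2']; exact hb.2.2.2.2⟩,
      by simp only [Tm.rank, h2, h2'], ?_⟩
    rintro _ ⟨a, ha, b, hb, rfl⟩
    exact inter_mem_lang (h3 ha) (h3' hb)

theorem ClosedSystem.sound_expand (hS : ClosedSystem (K + 1) rk R S) (d : ℕ) :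
    ∀ τ ∈ S, ∀ e ∈ expand K rk R S d τ, Sound K rk R S τ e := by
  refine expand_induction (P := fun τ E => ∀ e ∈ E, Sound K rk R S τ e) ?_ ?_
    (fun F hF => hS.sound_expandStep F hF) d
  · rintro τ h _ rfl
    exact ⟨h.2.trans K.lt_succ_self, rfl, subset_rfl⟩
  · rintro τ e ⟨⟩

/-- An unfolding of the topmost operation or rule in the derivation of a word that is not
pumpable. If the rank `K` is kept, then the word arises from the word of the child by an even
context. -/
theorem ClosedSystem.exists_mem_expandStep {N' : Type*} (hS : ClosedSystem (K + 1) rk R S)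
    {n : ℕ} {τ : Tm N σ} {u : SepWord σ} (hτ : τ ∈ S) (h : DerN R n τ u)
    (hu : ¬ Pumpable (K + 1) ⊤ (lang R τ) u) {F : Tm N σ → Set (Tm N' σ)}
    {V : N' → Set (SepWord σ)}
    (hF : ∀ c ∈ S, ∀ m < n, ∀ x, DerN R m c x → ¬ Pumpable (K + 1) ⊤ (lang R c) x →
      (c.rank rk = K → τ.rank rk = K →
        ∃ y z, u = wrap y z x ∧ ∀ x' ∈ lang R c, wrap y z x' ∈ lang R τ) →
      ∃ e ∈ F c, x ∈ e.eval V) :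
    ∃ e ∈ expandStep R F τ, u ∈ e.eval V := by
  have hb := hS.bounded τ hτ
  cases h with
  | nt hA h =>
    obtain ⟨hβ, hr⟩ := hS.nt _ _ hτ hA
    have hsub := fun x (hx : x ∈ lang R _) => mem_lang_nt.2 ⟨_, hA, hx⟩
    obtain ⟨e, he, hue⟩ := hF _ hβ _ (Nat.lt_succ_self _) _ h
      (fun hp => hu (hp.mono le_rfl le_rfl hsub))
      (fun _ _ => ⟨_, _, (wrap_nil _).symm, fun x hx => by rw [wrap_nil]; exact hsub x hx⟩)
    exact ⟨e, Set.mem_biUnion (s := {β | (_, β) ∈ R}) hA he, hue⟩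
  | word w => exact ⟨_, rfl, rfl⟩
  | sep => exact ⟨_, rfl, rfl⟩
  | @conc m n α β a b ha hb' =>
    obtain ⟨hα, hβ⟩ := hS.conc _ _ hτ
    have hsa := hS.seps_of_mem_lang hα ⟨_, ha⟩
    have hsb := hS.seps_of_mem_lang hβ ⟨_, hb'⟩
    have hl : ∀ x ∈ lang R α, x ++ b ∈ lang R (.conc α β) :=
      fun x hx => conc_mem_lang hx ⟨_, hb'⟩
    have hr : ∀ x ∈ lang R β, a ++ x ∈ lang R (.conc α β) :=
      fun x hx => conc_mem_lang ⟨_, ha⟩ hx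
    obtain ⟨e₁, he₁, hae⟩ := hF α hα m (by omega) a ha (fun hp => hu (hp.append b hl))
      -- If the rank stays `K`, then `b` has rank 0 and extends the last segment, which has number
      -- `K`.
      (fun hc ht => by
        simp only [Tm.rank] at ht
        obtain ⟨w, rfl⟩ := exists_eq_map_some (v := b) (by omega)
        have key : ∀ x ∈ lang R α, x ++ w.map some =
            wrap (fun _ => []) (fun i => if i = K then w else []) x := fun x hx => by
          rw [append_eq_wrap_right, hS.seps_of_mem_lang hα hx, hc]
        exact ⟨_, _, key a ⟨_, ha⟩, fun x hx => key x hx ▸ hl x hx⟩)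
    obtain ⟨e₂, he₂, hbe⟩ := hF β hβ n (by omega) b hb' (fun hp => hu (hp.prepend a hr))
      (fun hc ht => by
        simp only [Tm.rank] at ht
        obtain ⟨w, rfl⟩ := exists_eq_map_some (v := a) (by omega)
        exact ⟨_, _, append_eq_wrap_left w b, fun x hx =>
          append_eq_wrap_left w x ▸ hr x hx⟩)
    exact ⟨_, ⟨e₁, he₁, e₂, he₂, rfl⟩, a, hae, b, hbe, rfl⟩
  | @inter m n j α β a b ha hb' =>
    obtain ⟨hα, hβ⟩ := hS.inter _ _ _ hτ
    obtain ⟨-, -, hj, hjα, -⟩ := hb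
    have hsα : ∀ x ∈ lang R α, j ≤ seps x := fun x hx => by rwa [hS.seps_of_mem_lang hα hx]
    have hsa := hS.seps_of_mem_lang hα ⟨_, ha⟩
    have hsb := hS.seps_of_mem_lang hβ ⟨_, hb'⟩
    have hl : ∀ x ∈ lang R α, intercal j x b ∈ lang R (.inter j α β) :=
      fun x hx => inter_mem_lang hx ⟨_, hb'⟩
    have hr : ∀ x ∈ lang R β, intercal j a x ∈ lang R (.inter j α β) :=
      fun x hx => inter_mem_lang ⟨_, ha⟩ hx
    obtain ⟨e₁, he₁, hae⟩ := hF α hα m (by omega) a ha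
      (fun hp => hu (hp.intercal_left hj hsα b hl))
      (fun hc ht => by
        simp only [Tm.rank] at ht
        obtain ⟨d, e, rfl⟩ := exists_eq_of_seps_eq_one (v := b) (by omega)
        have key := fun x (hx : x ∈ lang R α) => intercal_eq_wrap d e hj (hsα x hx)
        exact ⟨_, _, key a ⟨_, ha⟩, fun x hx => key x hx ▸ hl x hx⟩)
    obtain ⟨e₂, he₂, hbe⟩ := hF β hβ n (by omega) b hb'
      (fun hp => hu (hp.intercal_right hj (hsα a ⟨_, ha⟩) hr))
      -- Here `a` is `d 1 e`, so `d` goes before the first segment and `e` after the last one.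
      (fun hc ht => by
        simp only [Tm.rank] at ht
        obtain rfl : j = 1 := by omega
        obtain ⟨d, e, rfl⟩ := exists_eq_of_seps_eq_one (v := a) (by omega)
        have key : ∀ x ∈ lang R β, intercal 1 (d.map some ++ none :: e.map some) x =
            wrap (fun i => if i = 0 then d else []) (fun i => if i = K then e else []) x :=
          fun x hx => by
          rw [intercal_split' (by simp), append_eq_wrap_left, append_eq_wrap_right,
            ← append_eq_wrap_left, seps_append, hS.seps_of_mem_lang hβ hx, hc, seps_map_some,
            append_eq_wrap_left, wrap_wrap]
          simp
        exact ⟨_, _, key b ⟨_, hb'⟩, fun x hx => key x hx ▸ hr x hx⟩)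
    exact ⟨_, ⟨e₁, he₁, e₂, he₂, rfl⟩, a, hae, b, hbe, rfl⟩

/-- A word that is not pumpable is a value of an expansion of depth `d`. The set `X` consists of
the terms met before on a path of terms of rank `K`. -/
theorem ClosedSystem.exists_mem_expand (hS : ClosedSystem (K + 1) rk R S)
    {V : LowTm K rk S → Set (SepWord σ)}
    (hV : ∀ A : LowTm K rk S, ∀ e ∈ expandStep R (expand K rk R S S.ncard) A.1,
      e.eval V ⊆ V A)
    (n : ℕ) {τ : Tm N σ} (hτ : τ ∈ S) {u : SepWord σ} (h : DerN R n τ u)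
    (hu : ¬ Pumpable (K + 1) ⊤ (lang R τ) u) {X : Set (Tm N σ)} (hX : X ⊆ S) {d : ℕ}
    (hd : S.ncard ≤ X.ncard + d)
    (hinv : τ.rank rk = K → ∀ s ∈ X, ∃ y z, (∀ x ∈ lang R τ, wrap y z x ∈ lang R s) ∧
      ¬ Pumpable (K + 1) ⊤ (lang R s) (wrap y z u) ∧ ∀ m ≤ n, ¬ DerN R m s (wrap y z u)) :
    ∃ e ∈ expand K rk R S d τ, u ∈ e.eval V := by
  induction n using Nat.strong_induction_on generalizing τ u X d with
  | _ n ih =>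
    -- The derivation may be assumed shortest, since the lower bounds in `hinv` only weaken as `n`
    -- decreases.
    by_cases hmin : ∃ m < n, DerN R m τ u
    · obtain ⟨m, hm, h'⟩ := hmin
      refine ih m hm hτ h' hu hX hd fun hr s hs => ?_
      obtain ⟨y, z, h1, h2, h3⟩ := hinv hr s hs
      exact ⟨y, z, h1, h2, fun i hi => h3 i (hi.trans hm.le)⟩
    push Not at hmin
    by_cases hlt : τ.rank rk < K
    · rw [expand_of_lt ⟨hτ, hlt⟩]
      -- Below a term of low rank the path of rank `K` terms starts afresh, with `X` empty and full
      -- depth.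
      obtain ⟨e, he, hue⟩ := hS.exists_mem_expandStep (F := expand K rk R S S.ncard) hτ h hu
        (V := V) fun c hc m hm x hx hxp _ => ih m hm hc hx hxp (Set.empty_subset S)
          (by simp) (by simp)
      exact ⟨_, rfl, hV ⟨τ, hτ, hlt⟩ e he hue⟩
    · have hr : τ.rank rk = K := by have := (hS.bounded τ hτ).rank_lt; omega
      specialize hinv hr
      -- On a repetition, the context from `τ` to itself is nontrivial: its word has no derivation
      -- from `τ` of size at most `n`, while `u` has one. Iterating it pumps a word that `hinv`
      -- declares not pumpable.
      have hτX : τ ∉ X := fun hmem => by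
        obtain ⟨y, z, h1, h2, h3⟩ := hinv τ hmem
        refine h2 (Pumpable.of_wrap y z ?_ h1 ⟨n, h⟩ fun heq => h3 n le_rfl (by rwa [heq]))
        rw [hS.seps_of_mem_lang hτ ⟨n, h⟩, hr]
      have hlt' : X.ncard < S.ncard :=
        Set.ncard_lt_ncard ⟨hX, fun hSX => hτX (hSX hτ)⟩ hS.finite
      obtain ⟨d, rfl⟩ : ∃ i, d = i + 1 := ⟨d - 1, by omega⟩
      rw [expand_succ_of_not_lt hlt]
      refine hS.exists_mem_expandStep hτ h hu fun c hc m hm x hx hxp hcx => ?_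
      refine ih m hm hc hx hxp (Set.insert_subset hτ hX) ?_ ?_
      · rw [Set.ncard_insert_of_notMem hτX (hS.finite.subset hX)]
        omega
      -- For `τ` itself the lower bound is minimality of `n`; for older terms the contexts are
      -- composed.
      · intro hcr s hs
        obtain ⟨y, z, rfl, hcl⟩ := hcx hcr hr
        obtain rfl | hs := hs
        · exact ⟨y, z, hcl, hu, fun i hi => hmin i (by omega)⟩
        · obtain ⟨y', z', h1, h2, h3⟩ := hinv s hs
          refine ⟨fun i => y' i ++ y i, fun i => z i ++ z' i, fun x' hx' => ?_, ?_, ?_⟩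
          · rw [← wrap_wrap]
            exact h1 _ (hcl x' hx')
          · rwa [← wrap_wrap]
          · rw [← wrap_wrap]
            exact fun i hi => h3 i (by omega)

/-! ### The induction on the rank -/

/-- If long values of the nonterminals are pumpable, then so are long values of a term. -/
theorem Tm.Bounded.exists_pumpable {m n k : ℕ} {V : N → Set (SepWord σ)}
    (hrk : ∀ A, ∀ v ∈ V A, seps v = rk A)
    (hV : ∀ A, ∀ v ∈ V A, n < v.length → Pumpable m ⊤ (V A) v) {e : Tm N σ}
    (he : e.Bounded k rk) :
    ∃ b : ℕ, ∀ v ∈ e.eval V, b < v.length → Pumpable m ⊤ (e.eval V) v := by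
  induction e with
  | nt A => exact ⟨n, hV A⟩
  | word w =>
    refine ⟨w.length, ?_⟩
    rintro _ rfl h
    simp at h
  | sep =>
    refine ⟨1, ?_⟩
    rintro _ rfl h
    simp at h
  | conc α β iha ihb =>
    obtain ⟨i, hi⟩ := iha he.1
    obtain ⟨i', hi'⟩ := ihb he.2.1
    refine ⟨i + i', ?_⟩
    rintro _ ⟨a, ha, b, hb, rfl⟩ h
    rw [List.length_append] at h
    by_cases hlt : i < a.length
    · exact (hi a ha hlt).append b fun x hx => ⟨x, hx, b, hb, rfl⟩
    · exact (hi' b hb (by omega)).prepend a fun x hx => ⟨a, ha, x, hx, rfl⟩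
  | inter j α β iha ihb =>
    obtain ⟨hα, hβ, hj, hjα, -⟩ := he
    obtain ⟨i, hi⟩ := iha hα
    obtain ⟨i', hi'⟩ := ihb hβ
    refine ⟨i + i', ?_⟩
    rintro _ ⟨a, ha, b, hb, rfl⟩ h
    have hs : ∀ x ∈ α.eval V, j ≤ seps x := fun x hx => by
      rwa [Tm.seps_of_mem_eval hrk hα hx]
    have := length_intercal_le j a b
    by_cases hlt : i < a.length
    · exact (hi a ha hlt).intercal_left hj hs b fun x hx => ⟨x, hx, b, hb, rfl⟩
    · exact (hi' b hb (by omega)).intercal_right hj (hs a ha) fun x hx => ⟨a, ha, x, hx, rfl⟩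

/-- Long words derived in systems of rank less than `K` can be pumped in at most `K` places. -/
def PumpingProperty (N : Type u) (σ : Type v) (K : ℕ) : Prop :=
  ∀ (rk : N → ℕ) (R : Set (N × Tm N σ)) (S : Set (Tm N σ)), ClosedSystem K rk R S →
    ∃ n : ℕ, ∀ τ ∈ S, ∀ v ∈ lang R τ, n < v.length → Pumpable K ⊤ (lang R τ) v

theorem pumpingProperty_zero (N : Type u) (σ : Type v) : PumpingProperty N σ 0 :=
  fun _ _ _ hS => ⟨0, fun τ hτ => absurd (hS.bounded τ hτ).rank_lt (Nat.not_lt_zero _)⟩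

/-- The induction hypothesis is applied to the system whose nonterminals are the low-rank terms of
`S` and whose rules are their unfoldings, freed of subterms of rank `K`. -/
theorem PumpingProperty.succ (ih : ∀ N' : Type max u v, PumpingProperty N' σ K) (N : Type u) :
    PumpingProperty N σ (K + 1) := by
  intro rk R S hS
  have hrk : ∀ A : LowTm K rk S, A.rank < K := fun A => A.2.2
  have hfin : Finite (LowTm K rk S) := (hS.finite.subset fun _ h => h.1).to_subtype
  have hconv : ∀ e : Tm (LowTm K rk S) σ, ∃ γ : Tm (LowTm K rk S) σ,
      e.Bounded (K + 1) LowTm.rank → e.rank LowTm.rank < K →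
        γ.Bounded K LowTm.rank ∧ γ.Equivalent LowTm.rank e := fun e => by
    by_cases h : e.Bounded (K + 1) LowTm.rank ∧ e.rank LowTm.rank < K
    · obtain ⟨γ, hγ⟩ := Tm.exists_bounded_equivalent hrk h.1 h.2
      exact ⟨γ, fun _ _ => hγ⟩
    · exact ⟨e, fun h1 h2 => absurd ⟨h1, h2⟩ h⟩
  choose conv hconv using hconv
  let E : LowTm K rk S → Set (Tm (LowTm K rk S) σ) :=
    fun A => expandStep R (expand K rk R S S.ncard) A.1
  have hE : ∀ A, ∀ e ∈ E A, Sound K rk R S A.1 e := fun A =>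
    hS.sound_expandStep _ (hS.sound_expand S.ncard) A.1 A.2.1
  have hconv' : ∀ A, ∀ e ∈ E A, (conv e).Bounded K LowTm.rank ∧
      (conv e).Equivalent LowTm.rank e := fun A e he =>
    hconv e (hE A e he).1 ((hE A e he).2.1 ▸ A.2.2)
  let R' : Set (LowTm K rk S × Tm (LowTm K rk S) σ) := ⋃ A, (fun e => (A, conv e)) '' E A
  have hmem : ∀ {A β}, (A, β) ∈ R' ↔ ∃ e ∈ E A, conv e = β := fun {A β} => by
    simp only [R', Set.mem_iUnion, Set.mem_image, Prod.mk.injEq]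
    constructor
    · rintro ⟨_, e, he, rfl, rfl⟩
      exact ⟨e, he, rfl⟩
    · rintro ⟨e, he, rfl⟩
      exact ⟨_, e, he, rfl, rfl⟩
  have hR' : R'.Finite := Set.finite_iUnion fun A =>
    (hS.finite_expandStep _ (hS.finite_expand S.ncard) A.1 A.2.1).image _
  obtain ⟨S', hS', hnt⟩ := exists_closedSystem (K := K) (rk := LowTm.rank) hR' hrk
    (by rintro ⟨A, β⟩ h; obtain ⟨e, he, rfl⟩ := hmem.1 h; exact (hconv' A e he).1)
    (by
      rintro ⟨A, β⟩ h
      obtain ⟨e, he, rfl⟩ := hmem.1 h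
      exact (hconv' A e he).2.1.trans (hE A e he).2.1)
  obtain ⟨n, hn⟩ := ih _ _ _ _ hS'
  have hsepV : ∀ A : LowTm K rk S, ∀ v ∈ lang R A.1, seps v = A.rank :=
    fun A v hv => hS.seps_of_mem_lang A.2.1 hv
  let V : LowTm K rk S → Set (SepWord σ) := fun A => lang R' (.nt A)
  have hsepV' : ∀ A : LowTm K rk S, ∀ v ∈ V A, seps v = A.rank :=
    fun A v hv => hS'.seps_of_mem_lang (hnt A) hv
  -- The old languages are closed under the new rules, hence contain the new ones.
  have hsound : ∀ e : Tm (LowTm K rk S) σ, e.eval V ⊆ e.eval fun A => lang R A.1 := fun e => by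
    rw [← lang_eq_eval R' e]
    refine lang_subset_eval (fun A β h => ?_) e
    obtain ⟨e, he, rfl⟩ := hmem.1 h
    rw [(hconv' A e he).2.2 _ hsepV]
    exact (hE A e he).2.2
  have hVE : ∀ A : LowTm K rk S, ∀ e ∈ E A, e.eval V ⊆ V A := fun A e he v hv => by
    refine mem_lang_nt.2 ⟨conv e, hmem.2 ⟨e, he, rfl⟩, ?_⟩
    rw [lang_eq_eval, (hconv' A e he).2.2 _ hsepV']
    exact hv
  have hbound : ∀ e : Tm (LowTm K rk S) σ, ∃ b : ℕ, e.Bounded (K + 1) LowTm.rank →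
      ∀ v ∈ e.eval V, b < v.length → Pumpable K ⊤ (e.eval V) v := fun e => by
    by_cases h : e.Bounded (K + 1) LowTm.rank
    · obtain ⟨b, hb⟩ := h.exists_pumpable hsepV' fun A => hn (.nt A) (hnt A)
      exact ⟨b, fun _ => hb⟩
    · exact ⟨0, fun h' => absurd h' h⟩
  choose bd hbd using hbound
  obtain ⟨B, hB⟩ := ((hS.finite.biUnion (hS.finite_expand (K := K) S.ncard)).image bd).bddAbove
  refine ⟨B, fun τ hτ v hv hlt => ?_⟩
  by_contra hnp
  obtain ⟨m, hm⟩ := id hv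
  obtain ⟨e, he, hve⟩ := hS.exists_mem_expand hVE m hτ hm hnp (Set.empty_subset S)
    (d := S.ncard) (by simp) (by simp)
  obtain ⟨h1, -, h3⟩ := hS.sound_expand S.ncard τ hτ e he
  have hle : bd e ≤ B := hB ⟨e, Set.mem_biUnion hτ he, rfl⟩
  exact hnp ((hbd e h1 v hve (by omega)).mono K.le_succ le_rfl ((hsound e).trans h3))

theorem pumpingProperty (N : Type u) (σ : Type v) (K : ℕ) : PumpingProperty N σ K := by
  -- The new nonterminals are terms over both `N` and `σ`, so the induction runs in the larger
  -- universe and a last step returns to `N`.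
  have h : ∀ K, ∀ N : Type max u v, PumpingProperty N σ K := fun K => by
    induction K with
    | zero => exact fun N => pumpingProperty_zero N σ
    | succ K ih => exact PumpingProperty.succ ih
  cases K with
  | zero => exact pumpingProperty_zero N σ
  | succ K => exact PumpingProperty.succ (h K) N

end Expansion

/-! ### Bounding the total length of the pumped part -/

section Grammars

variable {N σ : Type*}

/-- Long derived words can be pumped in a part of bounded total length. -/
theorem ClosedSystem.exists_pumpable {K : ℕ} {rk : N → ℕ} {R : Set (N × Tm N σ)}
    {S : Set (Tm N σ)} (hS : ClosedSystem K rk R S) :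
    ∃ n : ℕ, ∀ τ ∈ S, ∀ v ∈ lang R τ, n < v.length → Pumpable K n (lang R τ) v := by
  obtain ⟨n, hn⟩ := pumpingProperty N σ K rk R S hS
  let len : Tm N σ → ℕ := fun τ => match τ with
    | .word w => w.length
    | _ => 0
  obtain ⟨m, hm⟩ := (hS.finite.image len).bddAbove
  -- In a smallest subderivation with a word longer than `n`, that word is a leaf of length at most
  -- `m`, a separator, or made from two words of length at most `n`.
  refine ⟨2 * n + m + 1, fun τ hτ v hv hlt => ?_⟩
  suffices h : ∀ i τ v, DerN R i τ v → τ ∈ S → n < v.length →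
      Pumpable K (2 * n + m + 1 : ℕ) (lang R τ) v by
    obtain ⟨i, hi⟩ := hv
    exact h i τ v hi hτ (by omega)
  clear hlt hv hτ v τ
  intro i τ v h
  have hshort : ∀ τ ∈ S, ∀ v ∈ lang R τ, n < v.length → v.length ≤ 2 * n + m + 1 →
      Pumpable K (2 * n + m + 1 : ℕ) (lang R τ) v := fun τ hτ v hv h1 h2 =>
    (hn τ hτ v hv h1).length_bound.mono le_rfl (by exact_mod_cast h2) subset_rfl
  induction h with
  | nt hA _ ih =>
    exact fun hτ hlt => (ih (hS.nt _ _ hτ hA).1 hlt).mono le_rfl le_rfl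
      fun x hx => mem_lang_nt.2 ⟨_, hA, hx⟩
  | word w =>
    intro hτ hlt
    have : w.length ≤ m := hm ⟨_, hτ, rfl⟩
    exact hshort _ hτ _ ⟨0, .word w⟩ hlt (by rw [List.length_map]; omega)
  | sep => exact fun hτ hlt => hshort _ hτ _ ⟨0, .sep⟩ hlt (by simp)
  | @conc i i' α β a b ha hb iha ihb =>
    intro hτ hlt
    obtain ⟨hα, hβ⟩ := hS.conc _ _ hτ
    by_cases hla : n < a.length
    · exact (iha hα hla).append b fun x hx => conc_mem_lang hx ⟨_, hb⟩
    by_cases hlb : n < b.length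
    · exact (ihb hβ hlb).prepend a fun x hx => conc_mem_lang ⟨_, ha⟩ hx
    exact hshort _ hτ _ ⟨_, .conc ha hb⟩ hlt (by rw [List.length_append]; omega)
  | @inter i i' j α β a b ha hb iha ihb =>
    intro hτ hlt
    obtain ⟨hα, hβ⟩ := hS.inter _ _ _ hτ
    obtain ⟨-, -, hj, hjα, -⟩ := hS.bounded _ hτ
    have hs : ∀ x ∈ lang R α, j ≤ seps x := fun x hx => by rwa [hS.seps_of_mem_lang hα hx]
    by_cases hla : n < a.length
    · exact (iha hα hla).intercal_left hj hs b fun x hx => inter_mem_lang hx ⟨_, hb⟩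
    by_cases hlb : n < b.length
    · exact (ihb hβ hlb).intercal_right hj (hs a ⟨_, ha⟩) fun x hx => inter_mem_lang ⟨_, ha⟩ hx
    have := length_intercal_le j a b
    exact hshort _ hτ _ ⟨_, .inter ha hb⟩ hlt (by omega)

/-- The parts that could contain separators do not depend on `p`, so a condition on `f 1` suffices.
-/
theorem PumpFamily.exists_words {l b : ℕ} {f : ℕ → SepWord σ} (h : PumpFamily l b f)
    (h1 : seps (f 1) = 0) : ∃ (s : Fin (l + 1) → List σ) (y u z : Fin l → List σ),
      (∀ p, f p = (s 0 ++ cat fun i =>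
        pow (y i) p ++ u i ++ pow (z i) p ++ s i.succ).map some) ∧
      (cat fun i => y i ++ u i ++ z i).length = b ∧
      (f 1).length = (f 0).length + (cat fun i => y i ++ z i).length := by
  induction h with
  | const s =>
    obtain ⟨w, rfl⟩ := exists_eq_map_some h1
    exact ⟨fun _ => w, Fin.elim0, Fin.elim0, Fin.elim0, by simp [cat], by simp [cat],
      by simp [cat]⟩
  | cons t y₀ u₀ z₀ h ih =>
    simp only [seps_append, seps_map_some] at h1
    obtain ⟨w, rfl⟩ := exists_eq_map_some (v := t) (by omega)
    obtain ⟨s, y, u, z, h2, h3, h4⟩ := ih (by omega)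
    refine ⟨Fin.cons w s, Fin.cons y₀ y, Fin.cons u₀ u, Fin.cons z₀ z, fun p => ?_, ?_, ?_⟩
    · simp [h2 p, cat, List.ofFn_succ]
    · simp only [cat] at h3
      simp [cat, List.ofFn_succ, ← h3, Nat.add_assoc]
    · simp only [cat] at h4
      simp [cat, List.ofFn_succ, h4]
      omega

theorem Tm.Correct.rank_le {k : ℕ} {rk : N → ℕ} (hrk : ∀ A, rk A ≤ k) {α : Tm N σ}
    (h : α.Correct k rk) : α.rank rk ≤ max k 1 := by
  cases α with
  | nt A => exact (hrk A).trans (le_max_left _ _)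
  | word w => exact Nat.zero_le _
  | sep => exact le_max_right _ _
  | conc α β => exact h.2.2.trans (le_max_left _ _)
  | inter j α β =>
    obtain ⟨-, -, -, -, -, h⟩ := h
    simp only [rank]
    omega

/-- The assumption on the rank matters only for `k = 0`, where the separator is correct but has rank
1. An intercalation forces `k ≥ 1`, and then all correct terms have rank at most `k`. -/
theorem Tm.Correct.bounded {k : ℕ} {rk : N → ℕ} (hrk : ∀ A, rk A ≤ k) {α : Tm N σ}
    (h : α.Correct k rk) (hr : α.rank rk ≤ k) : α.Bounded (k + 1) rk := by
  induction α with
  | nt A => exact Nat.lt_succ_of_le (hrk A)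
  | word w => exact Nat.succ_pos k
  | sep => exact Nat.succ_lt_succ hr
  | conc α β iha ihb =>
    obtain ⟨h1, h2, h3⟩ := h
    exact ⟨iha h1 (by omega), ihb h2 (by omega), by omega⟩
  | inter j α β iha ihb =>
    obtain ⟨h1, h2, h3, h4, h5, h6⟩ := h
    have := h1.rank_le hrk
    exact ⟨iha h1 (by omega), ihb h2 (by omega), h3, h5, h6⟩

theorem Tm.Ground.value_mem_lang {R : Set (N × Tm N σ)} {α : Tm N σ} (h : α.Ground) :
    α.value ∈ lang R α := by
  induction α with
  | nt A => exact h.elim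
  | word w => exact ⟨0, .word w⟩
  | sep => exact ⟨0, .sep⟩
  | conc α β iha ihb => exact conc_mem_lang (iha h.1) (ihb h.2)
  | inter j α β iha ihb => exact inter_mem_lang (iha h.1) (ihb h.2)

/-! ### Comparing the rewriting relation with `lang` -/

namespace Ctx

/-- Composition of contexts. -/
def comp : Ctx N σ → Ctx N σ → Ctx N σ
  | hole, D => D
  | concL C β, D => concL (C.comp D) β
  | concR α C, D => concR α (C.comp D)
  | interL j C β, D => interL j (C.comp D) β
  | interR j α C, D => interR j α (C.comp D)

theorem plug_comp (C D : Ctx N σ) (γ : Tm N σ) : (C.comp D).plug γ = C.plug (D.plug γ) := by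
  induction C with
  | hole => rfl
  | _ => simp_all [comp, plug]

theorem lang_plug_mono {R : Set (N × Tm N σ)} (C : Ctx N σ) {α β : Tm N σ}
    (h : lang R α ⊆ lang R β) : lang R (C.plug α) ⊆ lang R (C.plug β) := by
  induction C with
  | hole => exact h
  | concL C γ ih =>
    rintro _ ⟨_, hv⟩
    cases hv with
    | conc h1 h2 => exact conc_mem_lang (ih ⟨_, h1⟩) ⟨_, h2⟩
  | concR γ C ih =>
    rintro _ ⟨_, hv⟩
    cases hv with
    | conc h1 h2 => exact conc_mem_lang ⟨_, h1⟩ (ih ⟨_, h2⟩)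
  | interL j C γ ih =>
    rintro _ ⟨_, hv⟩
    cases hv with
    | inter h1 h2 => exact inter_mem_lang (ih ⟨_, h1⟩) ⟨_, h2⟩
  | interR j γ C ih =>
    rintro _ ⟨_, hv⟩
    cases hv with
    | inter h1 h2 => exact inter_mem_lang ⟨_, h1⟩ (ih ⟨_, h2⟩)

theorem rank_plug {rk : N → ℕ} (C : Ctx N σ) {α β : Tm N σ} (h : α.rank rk = β.rank rk) :
    (C.plug α).rank rk = (C.plug β).rank rk := by
  induction C with
  | hole => exact h
  | _ => simp_all [plug, Tm.rank]

theorem correct_plug {k : ℕ} {rk : N → ℕ} (C : Ctx N σ) {α β : Tm N σ}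
    (h : α.rank rk = β.rank rk) (hβ : β.Correct k rk) (hC : (C.plug α).Correct k rk) :
    (C.plug β).Correct k rk := by
  induction C with
  | hole => exact hβ
  | concL C γ ih => exact ⟨ih hC.1, hC.2.1, rank_plug C h ▸ hC.2.2⟩
  | concR γ C ih => exact ⟨hC.1, ih hC.2.1, rank_plug C h ▸ hC.2.2⟩
  | interL j C γ ih =>
    obtain ⟨h1, h2, h3, h4, h5, h6⟩ := hC
    rw [rank_plug C h] at h5 h6
    exact ⟨ih h1, h2, h3, h4, h5, h6⟩
  | interR j γ C ih =>
    obtain ⟨h1, h2, h3, h4, h5, h6⟩ := hC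
    rw [rank_plug C h] at h6
    exact ⟨h1, ih h2, h3, h4, h5, h6⟩

end Ctx

namespace DCFG

variable {k : ℕ} (G : DCFG k σ)

theorem Derives.correct {G : DCFG k σ} {A : G.N} {α : Tm G.N σ} (h : G.Derives A α) :
    α.Correct k G.rk := by
  induction h with
  | refl => trivial
  | step C B β _ hr ih =>
    exact C.correct_plug (α := .nt B) (G.rank_rules _ hr).symm (G.correct_rules _ hr) ih

/-- Undoing a rewriting step inside a monotone context can only enlarge the language. -/
theorem Derives.lang_subset {G : DCFG k σ} {A : G.N} {α : Tm G.N σ} (h : G.Derives A α) :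
    lang G.rules α ⊆ lang G.rules (.nt A) := by
  induction h with
  | refl => exact subset_rfl
  | step C B β _ hr ih =>
    exact (C.lang_plug_mono fun v hv => mem_lang_nt.2 ⟨β, hr, hv⟩).trans ih

/-- The surrounding context is kept general so that the left child is made ground first and then
becomes part of the context of the right child. -/
theorem exists_ground {G : DCFG k σ} {A : G.N} {n : ℕ} {τ : Tm G.N σ} {v : SepWord σ}
    (h : DerN G.rules n τ v) (C : Ctx G.N σ) (hC : G.Derives A (C.plug τ)) :
    ∃ α : Tm G.N σ, G.Derives A (C.plug α) ∧ α.Ground ∧ α.value = v := by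
  induction h generalizing C with
  | nt hA _ ih => exact ih C (.step C _ _ hC hA)
  | word w => exact ⟨_, hC, trivial, rfl⟩
  | sep => exact ⟨_, hC, trivial, rfl⟩
  | @conc _ _ α β _ _ _ _ ih₁ ih₂ =>
    obtain ⟨α', h1, h2, rfl⟩ := ih₁ (C.comp (.concL .hole β)) (by rwa [Ctx.plug_comp])
    obtain ⟨β', h1', h2', rfl⟩ := ih₂ (C.comp (.concR α' .hole))
      (by rw [Ctx.plug_comp] at h1 ⊢; exact h1)
    exact ⟨.conc α' β', by rwa [Ctx.plug_comp] at h1', ⟨h2, h2'⟩, rfl⟩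
  | @inter _ _ j α β _ _ _ _ ih₁ ih₂ =>
    obtain ⟨α', h1, h2, rfl⟩ := ih₁ (C.comp (.interL j .hole β)) (by rwa [Ctx.plug_comp])
    obtain ⟨β', h1', h2', rfl⟩ := ih₂ (C.comp (.interR j α' .hole))
      (by rw [Ctx.plug_comp] at h1 ⊢; exact h1)
    exact ⟨.inter j α' β', by rwa [Ctx.plug_comp] at h1', ⟨h2, h2'⟩, rfl⟩

theorem derivable_eq_lang (A : G.N) : G.derivable A = lang G.rules (.nt A) := by
  ext v
  constructor
  · rintro ⟨α, h1, -, h2, rfl⟩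
    exact h1.lang_subset h2.value_mem_lang
  · rintro ⟨n, h⟩
    obtain ⟨α, h1, h2, h3⟩ := exists_ground h .hole .refl
    exact ⟨α, h1, h1.correct, h2, h3⟩

end DCFG

end Grammars

end Displacement

theorem mainTheorem1 {σ : Type*} [Finite σ] (k : ℕ) (L : Language σ)
    (hL : Displacement.IsDCFL k L) :
    ∃ n : ℕ, ∀ w ∈ L, n < w.length →
      ∃ l : ℕ, l ≤ k + 1 ∧ ∃ (s : Fin (l + 1) → List σ) (y u z : Fin l → List σ),
        w = s 0 ++ Displacement.cat (fun i => y i ++ u i ++ z i ++ s i.succ) ∧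
        0 < (Displacement.cat (fun i => y i ++ z i)).length ∧
        (Displacement.cat (fun i => y i ++ u i ++ z i)).length ≤ n ∧
        ∀ p : ℕ,
          s 0 ++ Displacement.cat (fun i =>
            Displacement.pow (y i) p ++ u i ++ Displacement.pow (z i) p ++ s i.succ) ∈ L := by
  obtain ⟨G, rfl⟩ := hL
  have := G.finite_N
  -- Rank at most `k` means rank below `k + 1`, whence the `k + 1` places.
  obtain ⟨S, hS, hnt⟩ := Displacement.exists_closedSystem (K := k + 1) (rk := G.rk)
    G.finite_rules (fun A => Nat.lt_succ_of_le (G.rk_le A))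
    (fun r hr => (G.correct_rules r hr).bounded G.rk_le (G.rank_rules r hr ▸ G.rk_le r.1))
    G.rank_rules
  have hmem : ∀ w : List σ, w ∈ G.language ↔
      w.map some ∈ Displacement.lang G.rules (.nt G.start) := fun w => by
    rw [← G.derivable_eq_lang]
    rfl
  obtain ⟨n, hn⟩ := hS.exists_pumpable
  refine ⟨n, fun w hw hlt => ?_⟩
  obtain ⟨l, b, f, hf, hl, hb, h1, h01, hfL⟩ :=
    hn _ (hnt G.start) _ ((hmem w).1 hw) (by rwa [List.length_map])
  obtain ⟨s, y, u, z, h2, h3, h4⟩ := hf.exists_words (by rw [h1, Displacement.seps_map_some])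
  refine ⟨l, hl, s, y, u, z, ?_, by omega, ?_, fun p => ?_⟩
  · have := (h2 1).symm.trans h1
    simp only [Displacement.pow_one] at this
    exact (List.map_injective_iff.2 (Option.some_injective σ) this).symm
  · rw [h3]
    exact_mod_cast hb
  · rw [hmem, ← h2 p]
    exact hfL p
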